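/- All graphs are finite and simple; $P_n$ and $C_n$ are the path and the cycle on $n$ vertices and $\Box$ is the Cartesian product. An edge-cut of $G$ is a set $F\subseteq E(G)$ such that $G-F$ is disconnected, and $G$ is super-edge-connected if every edge-cut of minimum cardinality is the set of all edges incident with some vertex. $G$ is $\{R,S\}$-free if no induced subgraph of $G$ is isomorphic to $R$ or $S$, and $\{R,S\}\preceq\{A,B\}$ means that each of $A,B$ has an induced subgraph isomorphic to $R$ or $S$. Let $H_0$ be two triangles sharing exactly one vertex, $Z_1$ a triangle with one pendant edge attached, and $T_{1,1,2}$ the tree formed by three paths of lengths $1,1,2$ with a common end vertex. **Theorem.** Let $R,S$ be connected graphs, neither of which is isomorphic to an induced subgraph of $P_3$, and put $\mathcal H=\{R,S\}$. Then every connected $\mathcal H$-free graph that is not isomorphic to $P_2\Box P_3$, nor to $P_n$ or $C_n$ for any $n\ge 4$, is super-edge-connected if and only if $\mathcal H\preceq\{H_0,P_4\}$ or $\mathcal H\preceq\{Z_1,T_{1,1,2}\}$. Moreover: (i) if $\mathcal H\preceq\{H_0,P_4\}$, then a connected $\mathcal H$-free graph $G$ is super-edge-connected if and only if $G\not\cong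 C_4$; (ii) if $\mathcal H\preceq\{Z_1,T_{1,1,2}\}$, then a connected $\mathcal H$-free graph $G$ is super-edge-connected if and only if $G\not\cong P_2\Box P_3$ and $G\not\cong P_n,C_n$ for all $n\ge4$. -/

import Mathlib

universe u v w

namespace SuperEdge

open SimpleGraph

/-- `F` is an edge-cut of `G`: a set of edges of `G` whose deletion leaves a disconnected graph. -/
def IsEdgeCut {V : Type u} (G : SimpleGraph V) (F : Set (Sym2 V)) : Prop :=
  F ⊆ G.edgeSet ∧ ¬ (G.deleteEdges F).Connected

/-- `F` is an edge-cut of minimum cardinality. It is used for finite graphs only, where every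
set of edges is finite and `Set.ncard` is the true cardinality. -/
def IsMinEdgeCut {V : Type u} (G : SimpleGraph V) (F : Set (Sym2 V)) : Prop :=
  IsEdgeCut G F ∧ ∀ F' : Set (Sym2 V), IsEdgeCut G F' → F.ncard ≤ F'.ncard

/-- `G` is super-edge-connected: each minimum edge-cut is the set of all edges incident with
some vertex. -/
def IsSuperEdgeConnected {V : Type u} (G : SimpleGraph V) : Prop :=
  ∀ F : Set (Sym2 V), IsMinEdgeCut G F → ∃ x : V, F = G.incidenceSet x

/-- `G` is `{R, S}`-free: no induced subgraph of `G` is isomorphic to `R` or to `S`. -/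
def PairFree {α : Type u} {β : Type v} {V : Type w} (R : SimpleGraph α) (S : SimpleGraph β)
    (G : SimpleGraph V) : Prop :=
  ¬ R.IsIndContained G ∧ ¬ S.IsIndContained G

/-- `{R, S} ⪯ {A, B}`: each of `A`, `B` has an induced subgraph isomorphic to `R` or to `S`. -/
def PairPrec {α : Type u} {β : Type v} {γ δ : Type} (R : SimpleGraph α) (S : SimpleGraph β)
    (A : SimpleGraph γ) (B : SimpleGraph δ) : Prop :=
  (R.IsIndContained A ∨ S.IsIndContained A) ∧ (R.IsIndContained B ∨ S.IsIndContained B)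

/-- `H₀`: two triangles `012` and `034` sharing exactly one vertex. -/
def H0 : SimpleGraph (Fin 5) :=
  fromEdgeSet {s(0, 1), s(0, 2), s(1, 2), s(0, 3), s(0, 4), s(3, 4)}

/-- `Z₁`: a triangle `012` with one pendant edge `03` attached. -/
def Z1 : SimpleGraph (Fin 4) :=
  fromEdgeSet {s(0, 1), s(0, 2), s(1, 2), s(0, 3)}

/-- `T_{1,1,2}`: the tree formed by three paths of lengths 1, 1, 2 with the common end `0`. -/
def T112 : SimpleGraph (Fin 5) :=
  fromEdgeSet {s(0, 1), s(0, 2), s(0, 3), s(3, 4)}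

/-- `G` is isomorphic to the cycle `C₄`. -/
def IsC4 {V : Type u} (G : SimpleGraph V) : Prop :=
  Nonempty (G ≃g cycleGraph 4)

/-- `G` is isomorphic to `P₂ □ P₃`, or to `P_n` or `C_n` for some `n ≥ 4`
(`P_n` and `C_n` have `n` vertices). -/
def IsLadderPathOrCycle {V : Type u} (G : SimpleGraph V) : Prop :=
  Nonempty (G ≃g (pathGraph 2).boxProd (pathGraph 3)) ∨
    ∃ n : ℕ, 4 ≤ n ∧ (Nonempty (G ≃g pathGraph n) ∨ Nonempty (G ≃g cycleGraph n))

end SuperEdge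

namespace SuperEdge

open SimpleGraph Finset

/-! Write δ for the minimum degree. If a connected graph is not super-edge-connected, a minimum
edge-cut that is not a star yields a bipartition X, Y with at least two vertices on each side and at
most δ edges across, since every star is itself an edge-cut (`exists_tightCut`). Counting degrees on
one side gives |X|, |Y| ≥ δ (`TightCut.le_card`). Sufficiency is the analysis of such tight cuts.

Without induced H₀ and P₄, the diameter is at most two, so on one side, say X, every vertex has a
neighbour across. Then |X| ≤ e(X, Y) ≤ δ ≤ |X|, so X is a clique and each of its vertices has
exactly one edge across (`TightCut.clique_of_forall_exists`). If all these edges end in one vertex,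
there is an H₀; otherwise excluding P₄ leaves only C₄.

Without induced Z₁ and T₁₁₂, a graph with a triangle is complete multipartite
(`adj_or_adj_of_triangle`), hence has no induced P₄ or H₀ and falls under the first case. A
triangle-free one is a path or a cycle if its degrees are at most two. Otherwise it is complete
bipartite up to a matching (`exists_isNearlyComplete`), and counting the edges between the four
quarters cut out by the bipartition and the tight cut leaves K₃,₃ minus two disjoint edges, which is
P₂ □ P₃.

For necessity, T₁₁₂, H₀ and two linked triangles are neither super-edge-connected nor exceptional,
so each contains R or S. If R lies in T₁₁₂, it cannot lie in H₀, so S does; whichever of R, S lies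
in the linked triangles decides between the two pairs (`pairPrec_of_isIndContained_T112`). -/

/-- A bipartition `X, Y` of the vertices into two parts with at least two vertices each, joined by
at most as many edges as the degree of any vertex. -/
structure TightCut {V : Type u} [Fintype V] (G : SimpleGraph V) [DecidableRel G.Adj]
    (X Y : Finset V) : Prop where
  cover : ∀ v, v ∈ X ∨ v ∈ Y
  disj : ∀ v, v ∈ X → v ∉ Y
  one_lt_left : 1 < #X
  one_lt_right : 1 < #Y
  le_degree : ∀ v, #(G.interedges X Y) ≤ G.degree v

theorem TightCut.symm {V : Type u} [Fintype V] {G : SimpleGraph V} [DecidableRel G.Adj]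
    {X Y : Finset V} (h : TightCut G X Y) : TightCut G Y X where
  cover v := (h.cover v).symm
  disj v hY hX := h.disj v hX hY
  one_lt_left := h.one_lt_right
  one_lt_right := h.one_lt_left
  le_degree v := by
    have : Std.Symm G.Adj := ⟨fun _ _ h => h.symm⟩
    have : #(G.interedges Y X) = #(G.interedges X Y) := Rel.card_interedges_comm ..
    rw [this]; exact h.le_degree v

/-! ### Edge-cuts, sides and tight cuts -/

theorem exists_side_of_isEdgeCut {V : Type u} [Nonempty V] {G : SimpleGraph V} {F : Set (Sym2 V)}
    (hF : IsEdgeCut G F) :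
    ∃ X : Set V, X.Nonempty ∧ Xᶜ.Nonempty ∧ ∀ a ∈ X, ∀ b ∉ X, G.Adj a b → s(a, b) ∈ F := by
  obtain ⟨-, hF⟩ := hF
  rw [connected_iff] at hF
  have : ¬ (G.deleteEdges F).Preconnected := fun h => hF ⟨h, inferInstance⟩
  simp only [Preconnected, not_forall] at this
  obtain ⟨u, v, huv⟩ := this
  refine ⟨{w | (G.deleteEdges F).Reachable u w}, ⟨u, .refl u⟩, ⟨v, huv⟩, fun a ha b hb hab => ?_⟩
  by_contra hn
  refine hb (Reachable.trans ha (Adj.reachable ?_))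
  simp [hab, hn]

theorem isEdgeCut_of_side {V : Type u} {G : SimpleGraph V} {F : Set (Sym2 V)}
    (hF : F ⊆ G.edgeSet) {X : Set V} (hX : X.Nonempty) (hY : Xᶜ.Nonempty)
    (h : ∀ a ∈ X, ∀ b ∉ X, G.Adj a b → s(a, b) ∈ F) : IsEdgeCut G F := by
  refine ⟨hF, fun hc => ?_⟩
  obtain ⟨a, ha⟩ := hX
  obtain ⟨b, hb⟩ := hY
  obtain ⟨p⟩ := hc.preconnected a b
  obtain ⟨d, -, h1, h2⟩ := p.exists_boundary_dart X ha hb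
  have := d.adj
  rw [deleteEdges_adj] at this
  exact this.2 (h _ h1 _ h2 this.1)

theorem isEdgeCut_incidenceSet {V : Type u} [Nontrivial V] (G : SimpleGraph V) (v : V) :
    IsEdgeCut G (G.incidenceSet v) := by
  refine isEdgeCut_of_side (G.incidenceSet_subset v) (X := {v}) ⟨v, rfl⟩ ?_ ?_
  · obtain ⟨w, hw⟩ := exists_ne v
    exact ⟨w, hw⟩
  · rintro a rfl b - hab
    exact ⟨hab, Sym2.mem_mk_left a b⟩

theorem exists_tightCut {V : Type u} [Fintype V] [DecidableEq V] {G : SimpleGraph V}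
    [DecidableRel G.Adj] (hG : G.Connected) (hs : ¬ IsSuperEdgeConnected G) :
    ∃ X Y, TightCut G X Y := by
  classical
  simp only [IsSuperEdgeConnected, not_forall, not_exists] at hs
  obtain ⟨F, hF, hinc⟩ := hs
  have := hG.nonempty
  obtain ⟨X, hX, hY, hXY⟩ := exists_side_of_isEdgeCut hF.1
  have : Nontrivial V := by
    obtain ⟨a, ha⟩ := hX
    obtain ⟨b, hb⟩ := hY
    exact ⟨a, b, fun h => hb (h ▸ ha)⟩
  have hdeg : ∀ v, (G.incidenceSet v).ncard = G.degree v := fun v => by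
    rw [← card_incidenceSet_eq_degree, Set.ncard_eq_toFinset_card', Set.toFinset_card]
  have hle : ∀ v, F.ncard ≤ (G.incidenceSet v).ncard := fun v =>
    hF.2 _ (isEdgeCut_incidenceSet G v)
  -- A star inside `F` would equal `F` by minimality. This is what excludes a side with a single
  -- vertex.
  have hne : ∀ v, ¬ G.incidenceSet v ⊆ F := fun v hv =>
    hinc v (Set.eq_of_subset_of_ncard_le hv (hle v) (Set.toFinite _)).symm
  refine ⟨X.toFinset, Xᶜ.toFinset, by simp [em], by simp, ?_, ?_, fun v => ?_⟩
  · by_contra hc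
    obtain ⟨x, hx⟩ := hX
    have hx' : ∀ b ∈ X, b = x := fun b hb =>
      Finset.card_le_one.mp (not_lt.mp hc) b (by simpa) x (by simpa)
    refine hne x fun e he => ?_
    induction e with | _ a b =>
    obtain ⟨he, hxe⟩ := he
    rw [mem_edgeSet] at he
    rcases Sym2.mem_iff.mp hxe with rfl | rfl
    · exact hXY _ hx _ (fun hb => he.ne (hx' b hb).symm) he
    · rw [Sym2.eq_swap]
      exact hXY _ hx _ (fun hb => he.ne (hx' a hb)) he.symm
  · by_contra hc
    obtain ⟨x, hx⟩ := hY
    have hx' : ∀ b, b ∉ X → b = x := fun b hb =>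
      Finset.card_le_one.mp (not_lt.mp hc) b (by simpa) x (by simpa using hx)
    refine hne x fun e he => ?_
    induction e with | _ a b =>
    obtain ⟨he, hxe⟩ := he
    rw [mem_edgeSet] at he
    rcases Sym2.mem_iff.mp hxe with rfl | rfl
    · rw [Sym2.eq_swap]
      exact hXY _ (by_contra fun hb => he.ne (hx' b hb).symm) _ hx he.symm
    · exact hXY _ (by_contra fun hb => he.ne (hx' a hb)) _ hx he
  · rw [← hdeg v]
    refine le_trans ?_ (hle v)
    rw [Set.ncard_eq_toFinset_card']
    refine Finset.card_le_card_of_injOn (fun p => s(p.1, p.2)) ?_ ?_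
    · rintro ⟨a, b⟩ h
      simp only [Finset.mem_coe, mk_mem_interedges_iff, Set.mem_toFinset, Set.mem_compl_iff] at h ⊢
      exact hXY a h.1 b h.2.1 h.2.2
    · rintro ⟨a, b⟩ h ⟨c, d⟩ h' he
      simp only [Finset.mem_coe, mk_mem_interedges_iff, Set.mem_toFinset, Set.mem_compl_iff] at h h'
      rcases Sym2.eq_iff.mp he with ⟨rfl, rfl⟩ | ⟨rfl, rfl⟩
      · rfl
      · exact absurd h'.1 h.2.1

theorem card_interedges_eq_sum {V : Type u} (G : SimpleGraph V)
    [DecidableRel G.Adj] (X Y : Finset V) :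
    #(G.interedges X Y) = ∑ x ∈ X, #{y ∈ Y | G.Adj x y} := by
  simp only [interedges, Rel.interedges, Finset.card_filter, Finset.sum_product]

/-- The degree sum over one side of a cut counts the edges inside it twice, the edges across
once. -/
theorem sum_degree_side {V : Type u} [Fintype V] [DecidableEq V] {G : SimpleGraph V}
    [DecidableRel G.Adj] {X Y : Finset V} (h : TightCut G X Y) :
    ∑ x ∈ X, G.degree x = ∑ x ∈ X, #{y ∈ X | G.Adj x y} + #(G.interedges X Y) := by
  rw [card_interedges_eq_sum, ← Finset.sum_add_distrib]
  refine Finset.sum_congr rfl fun x _ => ?_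
  have hd : Disjoint {y ∈ X | G.Adj x y} {y ∈ Y | G.Adj x y} :=
    Finset.disjoint_filter_filter (Finset.disjoint_left.mpr (h.disj · ))
  rw [← Finset.card_union_of_disjoint hd, ← card_neighborFinset_eq_degree]
  congr 1
  ext y
  have := h.cover y
  simp; tauto

/-- With δ = deg v, the degree sum over `X` gives |X|δ ≤ |X|(|X| - 1) + δ; divide by |X| - 1 > 0. -/
theorem TightCut.le_card {V : Type u} [Fintype V] [DecidableEq V] {G : SimpleGraph V}
    [DecidableRel G.Adj] {X Y : Finset V} (h : TightCut G X Y) (v : V)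
    (hv : ∀ w, G.degree v ≤ G.degree w) : G.degree v ≤ #X := by
  have h1 := sum_degree_side h
  have h2 : #X * G.degree v ≤ ∑ x ∈ X, G.degree x := by
    simpa using Finset.card_nsmul_le_sum X (G.degree ·) _ fun x _ => hv x
  have h3 : ∑ x ∈ X, #{y ∈ X | G.Adj x y} ≤ #X * (#X - 1) := by
    simpa using Finset.sum_le_card_nsmul X _ (#X - 1) fun x hx => by
      rw [← Finset.card_erase_of_mem hx]
      refine Finset.card_le_card fun y hy => ?_
      simp only [Finset.mem_filter, Finset.mem_erase] at hy ⊢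
      exact ⟨hy.2.ne', hy.1⟩
  have h4 := h.le_degree v
  have h5 := h.one_lt_left
  obtain ⟨n, hn⟩ : ∃ n, #X = n + 2 := ⟨#X - 2, by omega⟩
  rw [hn] at h2 h3 ⊢
  simp only [show n + 2 - 1 = n + 1 by omega] at h3
  nlinarith

/-! ### Graphs that are not super-edge-connected -/

theorem IsEdgeCut.image {V : Type u} {W : Type v} [Nonempty V] {G : SimpleGraph V}
    {H : SimpleGraph W} (e : G ≃g H) {F : Set (Sym2 V)} (hF : IsEdgeCut G F) :
    IsEdgeCut H (Sym2.map e '' F) := by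
  obtain ⟨X, ⟨a, ha⟩, ⟨b, hb⟩, hXY⟩ := exists_side_of_isEdgeCut hF
  refine isEdgeCut_of_side (X := e.symm ⁻¹' X) ?_ ⟨e a, by simpa⟩ ⟨e b, by simpa using hb⟩ ?_
  · rintro _ ⟨x, hx, rfl⟩
    have := hF.1 hx
    induction x with | _ x y =>
    exact e.map_adj_iff.mpr this
  · intro a ha b hb hab
    exact ⟨s(e.symm a, e.symm b), hXY _ ha _ hb (e.symm.map_adj_iff.mpr hab), by simp⟩

theorem IsSuperEdgeConnected.of_iso {V : Type u} {W : Type v} {G : SimpleGraph V}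
    {H : SimpleGraph W} (e : G ≃g H) (hG : G.Connected) (h : IsSuperEdgeConnected H) :
    IsSuperEdgeConnected G := by
  have := hG.nonempty
  have : Nonempty W := this.map e
  intro F hF
  have hinj : Function.Injective (Sym2.map e) := Sym2.map.injective e.injective
  obtain ⟨x, hx⟩ := h (Sym2.map e '' F) ⟨hF.1.image e, fun F' hF' => by
    rw [Set.ncard_image_of_injective _ hinj,
      ← Set.ncard_image_of_injective F' (Sym2.map.injective e.symm.injective)]
    exact hF.2 _ (hF'.image e.symm)⟩
  refine ⟨e.symm x, ?_⟩
  ext s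
  rw [← hinj.mem_set_image, hx]
  induction s with | _ a b =>
  simp [incidenceSet, RelIso.symm_apply_eq, e.map_adj_iff]

/-- A bridge none of whose ends is a leaf prevents super-edge-connectedness. -/
theorem not_isSuperEdgeConnected_of_bridge {V : Type u} [Finite V] {G : SimpleGraph V}
    (hG : G.Connected) {a a' b b' : V} (hab : G.Adj a b) (ha : G.Adj a a') (hb : G.Adj b b')
    (hab' : a' ≠ b) (hba' : b' ≠ a) (X : Set V) (haX : a ∈ X) (hbX : b ∉ X)
    (hX : ∀ x ∈ X, ∀ y ∉ X, G.Adj x y → x = a ∧ y = b) : ¬ IsSuperEdgeConnected G := by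
  intro h
  obtain ⟨x, hx⟩ := h {s(a, b)} ⟨isEdgeCut_of_side (by simpa) ⟨a, haX⟩ ⟨b, hbX⟩
    fun x hx y hy hxy => by obtain ⟨rfl, rfl⟩ := hX x hx y hy hxy; rfl, fun F hF => by
      rw [Set.ncard_singleton, Nat.one_le_iff_ne_zero, Ne, Set.ncard_eq_zero (Set.toFinite F)]
      rintro rfl
      exact hF.2 (by simpa)⟩
  have h1 : s(a, b) ∈ G.incidenceSet x := hx ▸ rfl
  rcases Sym2.mem_iff.mp h1.2 with rfl | rfl
  · have : s(x, a') ∈ ({s(x, b)} : Set (Sym2 V)) := hx ▸ ⟨ha, Sym2.mem_mk_left _ _⟩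
    simp [hab'] at this
    exact ha.ne this.2.symm
  · have : s(x, b') ∈ ({s(a, x)} : Set (Sym2 V)) := hx ▸ ⟨hb, Sym2.mem_mk_left _ _⟩
    simp at this
    grind

open Fin.NatCast in
/-- In a graph with a closed spanning trail, an edge-cut of two edges that is not the star of a
vertex prevents super-edge-connectedness. -/
theorem not_isSuperEdgeConnected_of_trail {V : Type u} [Finite V] {G : SimpleGraph V} {n : ℕ}
    (f : Fin (n + 1) → V) (hsurj : Function.Surjective f) (hadj : ∀ i, G.Adj (f i) (f (i + 1)))
    (hinj : Function.Injective fun i => s(f i, f (i + 1))) {e₁ e₂ : Sym2 V}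
    (h₁ : e₁ ∈ G.edgeSet) (h₂ : e₂ ∈ G.edgeSet) (hinc : ∀ x, {e₁, e₂} ≠ G.incidenceSet x)
    (X : Set V) (hX : X.Nonempty) (hX' : Xᶜ.Nonempty)
    (hcut : ∀ x ∈ X, ∀ y ∉ X, G.Adj x y → s(x, y) = e₁ ∨ s(x, y) = e₂) :
    ¬ IsSuperEdgeConnected G := by
  -- A closed trail through all vertices must leave every proper nonempty set. Applied to a side and
  -- to its complement, this puts two different edges of the trail into every edge-cut.
  have key : ∀ Z : Set V, Z.Nonempty → Zᶜ.Nonempty → ∃ i, f i ∈ Z ∧ f (i + 1) ∉ Z := by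
    rintro Z ⟨a, ha⟩ ⟨b, hb⟩
    obtain ⟨i, rfl⟩ := hsurj a
    obtain ⟨j, rfl⟩ := hsurj b
    by_contra! hc
    have hk : ∀ k : ℕ, f (i + k) ∈ Z := by
      intro k
      induction k with
      | zero => simpa
      | succ k ih => have := hc _ ih; push_cast; rwa [← add_assoc]
    apply hb
    have := hk (j - i).val
    rwa [Fin.cast_val_eq_self, add_sub_cancel] at this
  intro h
  obtain ⟨x, hx⟩ := h {e₁, e₂} ⟨isEdgeCut_of_side (by grind) hX hX' (by simpa using hcut),
    fun F hF => by
      have : Nonempty V := ⟨f 0⟩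
      obtain ⟨Z, hZ, hZ', hF'⟩ := exists_side_of_isEdgeCut hF
      obtain ⟨i, hi, hi'⟩ := key Z hZ hZ'
      obtain ⟨j, hj, hj'⟩ := key Zᶜ hZ' (by simpa)
      have hij : i ≠ j := by rintro rfl; exact hj hi
      have : 2 ≤ F.ncard := by
        rw [← Set.ncard_pair (hinj.ne hij)]
        refine Set.ncard_le_ncard ?_ (Set.toFinite F)
        rintro _ (rfl | rfl)
        · exact hF' _ hi _ hi' (hadj i)
        · rw [Sym2.eq_swap]
          exact hF' _ (by simpa using hj') _ hj (hadj j).symm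
      exact (Set.ncard_insert_le _ _).trans (by simpa)⟩
  exact hinc x hx

theorem ne_incidenceSet_of_disjoint {V : Type u} {G : SimpleGraph V} {a b c d : V}
    (hac : a ≠ c) (had : a ≠ d) (hbc : b ≠ c) (hbd : b ≠ d) (x : V) :
    {s(a, b), s(c, d)} ≠ G.incidenceSet x := by
  intro h
  have h1 : s(a, b) ∈ G.incidenceSet x := h ▸ by simp
  have h2 : s(c, d) ∈ G.incidenceSet x := h ▸ by simp
  have h1 := Sym2.mem_iff.mp h1.2
  have h2 := Sym2.mem_iff.mp h2.2
  grind

theorem not_isSuperEdgeConnected_pathGraph (n : ℕ) :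
    ¬ IsSuperEdgeConnected (pathGraph (n + 4)) := by
  refine not_isSuperEdgeConnected_of_bridge (pathGraph_connected _)
    (a := ⟨1, by omega⟩) (a' := ⟨0, by omega⟩) (b := ⟨2, by omega⟩) (b' := ⟨3, by omega⟩)
    ?_ ?_ ?_ ?_ ?_ {i | i.val ≤ 1} ?_ ?_ ?_
  all_goals simp [pathGraph_adj, Fin.ext_iff]
  intros; omega

theorem not_isSuperEdgeConnected_cycleGraph (n : ℕ) :
    ¬ IsSuperEdgeConnected (cycleGraph (n + 4)) := by
  have hadj : ∀ i : Fin (n + 4), (cycleGraph (n + 4)).Adj i (i + 1) := fun i => by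
    rw [cycleGraph_adj]; simp
  have h2 : (2 : Fin (n + 4)).val = 2 := Nat.mod_eq_of_lt (a := 2) (by omega)
  have h3 : (3 : Fin (n + 4)).val = 3 := Nat.mod_eq_of_lt (a := 3) (by omega)
  have h12 : (1 : Fin (n + 4)) + 1 = 2 := by
    ext; simp [Fin.val_add]
  have h23 : (2 : Fin (n + 4)) + 1 = 3 := by
    ext; simp [Fin.val_add]
  have h02 : (0 : Fin (n + 4)) ≠ 2 := Fin.ne_of_val_ne (by rw [h2]; simp)
  have h03 : (0 : Fin (n + 4)) ≠ 3 := Fin.ne_of_val_ne (by rw [h3]; simp)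
  refine not_isSuperEdgeConnected_of_trail (n := n + 3) id Function.surjective_id hadj ?_
    (e₁ := s(0, 1)) (e₂ := s(2, 3)) (by simpa using hadj 0) (by simpa [h23] using hadj 2)
    (ne_incidenceSet_of_disjoint ?_ ?_ ?_ ?_) {1, 2} ⟨1, by simp⟩ ⟨0, ?_⟩ ?_
  · intro i j hij
    simp only [id, Sym2.eq_iff] at hij
    rcases hij with h | ⟨h, h'⟩
    · exact h.1
    · exfalso
      -- The same edge traversed backwards would give 2 = 0 modulo n + 4.
      rw [h, add_assoc, h12] at h'
      have := congrArg Fin.val (left_eq_add.mp h'.symm)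
      rw [h2] at this
      simp at this
  · exact h02
  · exact h03
  · exact Fin.ne_of_val_ne (by rw [h2]; simp)
  · exact Fin.ne_of_val_ne (by rw [h3]; simp)
  · simp [h02]
  rintro x hx y hy hxy
  rw [cycleGraph_adj, sub_eq_iff_eq_add, sub_eq_iff_eq_add] at hxy
  have h32 : (1 : Fin (n + 4)) + 2 = 3 := (add_comm 1 2).trans h23
  rcases hx with rfl | rfl <;> rcases hxy with h | rfl
  · left; rw [left_eq_add] at h; subst h; exact Sym2.eq_swap
  · simp [h12] at hy
  · rw [← h12, add_right_inj] at h; subst h; simp at hy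
  · simp [h32]

theorem not_isSuperEdgeConnected_ladder :
    ¬ IsSuperEdgeConnected ((pathGraph 2).boxProd (pathGraph 3)) := by
  refine not_isSuperEdgeConnected_of_trail (n := 5)
    -- The Hamiltonian cycle around the ladder; the cut splits off the end rung.
    ![(0, 0), (0, 1), (0, 2), (1, 2), (1, 1), (1, 0)] (by decide) ?_ (by decide)
    (e₁ := s((0, 0), (0, 1))) (e₂ := s((1, 0), (1, 1)))
    (by simp [pathGraph_adj]) (by simp [pathGraph_adj])
    (ne_incidenceSet_of_disjoint (by decide) (by decide) (by decide) (by decide))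
    {x | x.2 = 0} ⟨(0, 0), rfl⟩ ⟨(0, 1), by simp⟩ ?_
  · intro i
    fin_cases i <;> simp [pathGraph_adj, boxProd_adj]
  · rintro ⟨a, b⟩ h ⟨c, d⟩ h' h''
    simp only [boxProd_adj, pathGraph_adj, Set.mem_ofPred_eq] at h h' h''
    subst h
    revert a c d
    decide

theorem not_isSuperEdgeConnected_H0 : ¬ IsSuperEdgeConnected H0 := by
  refine not_isSuperEdgeConnected_of_trail (n := 5)
    -- An Eulerian tour, passing through the centre twice. The two cut edges share the centre, whose
    -- star is larger.
    ![0, 1, 2, 0, 3, 4] (by decide) ?_ (by decide)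
    (e₁ := s(0, 1)) (e₂ := s(0, 2)) (by simp [H0]) (by simp [H0]) ?_
    {x | x = 1 ∨ x = 2} ⟨1, by simp⟩ ⟨0, by simp⟩ ?_
  · intro i
    fin_cases i <;> simp [H0]
  · intro x hx
    have h1 : s(0, 1) ∈ H0.incidenceSet x := hx ▸ by simp
    have h2 : s(0, 2) ∈ H0.incidenceSet x := hx ▸ by simp
    have h1 := Sym2.mem_iff.mp h1.2
    have h2 := Sym2.mem_iff.mp h2.2
    have hx0 : x = 0 := by grind
    subst hx0
    have : s(0, 3) ∈ H0.incidenceSet 0 := ⟨by simp [H0], by simp⟩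
    rw [← hx] at this
    revert this
    simp
  · rintro a h c h' h''
    simp only [H0, fromEdgeSet_adj, Set.mem_ofPred_eq, Set.mem_insert_iff,
      Set.mem_singleton_iff] at h h' h'' ⊢
    revert a c
    decide

/-- Two triangles `012` and `345` joined by the edge `03`. -/
def linkedTriangles : SimpleGraph (Fin 6) :=
  fromEdgeSet {s(0, 1), s(0, 2), s(1, 2), s(3, 4), s(3, 5), s(4, 5), s(0, 3)}

theorem H0_connected : H0.Connected := by
  rw [connected_iff_exists_forall_reachable]
  refine ⟨0, fun v => ?_⟩
  by_cases hv : v = 0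
  · exact hv ▸ .refl _
  · exact Adj.reachable (by fin_cases v <;> simp [H0] at hv ⊢)

theorem T112_connected : T112.Connected := by
  rw [connected_iff_exists_forall_reachable]
  refine ⟨0, fun v => ?_⟩
  have h3 : T112.Reachable 0 3 := Adj.reachable (by simp [T112])
  fin_cases v
  · exact .refl _
  · exact Adj.reachable (by simp [T112])
  · exact Adj.reachable (by simp [T112])
  · exact h3
  · exact h3.trans (Adj.reachable (by simp [T112]))

theorem linkedTriangles_connected : linkedTriangles.Connected := by
  rw [connected_iff_exists_forall_reachable]
  refine ⟨0, fun v => ?_⟩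
  have h3 : linkedTriangles.Reachable 0 3 := Adj.reachable (by simp [linkedTriangles])
  fin_cases v
  · exact .refl _
  · exact Adj.reachable (by simp [linkedTriangles])
  · exact Adj.reachable (by simp [linkedTriangles])
  · exact h3
  · exact h3.trans (Adj.reachable (by simp [linkedTriangles]))
  · exact h3.trans (Adj.reachable (by simp [linkedTriangles]))

theorem not_isSuperEdgeConnected_T112 : ¬ IsSuperEdgeConnected T112 := by
  refine not_isSuperEdgeConnected_of_bridge T112_connected
    (a := 0) (a' := 1) (b := 3) (b' := 4) ?_ ?_ ?_ ?_ ?_ {i | i.val ≤ 2} ?_ ?_ ?_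
  any_goals simp [T112]
  decide

theorem not_isSuperEdgeConnected_linkedTriangles : ¬ IsSuperEdgeConnected linkedTriangles := by
  refine not_isSuperEdgeConnected_of_bridge linkedTriangles_connected
    (a := 0) (a' := 1) (b := 3) (b' := 4) ?_ ?_ ?_ ?_ ?_ {i | i.val ≤ 2} ?_ ?_ ?_
  any_goals simp [linkedTriangles]
  decide

theorem not_isSuperEdgeConnected_of_isC4 {V : Type u} {G : SimpleGraph V} (h : IsC4 G) :
    ¬ IsSuperEdgeConnected G := fun hs =>
  h.elim fun e => not_isSuperEdgeConnected_cycleGraph 0 <|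
    hs.of_iso e.symm cycleGraph_connected

theorem ladder_connected : ((pathGraph 2).boxProd (pathGraph 3)).Connected :=
  (pathGraph_connected 1).boxProd (pathGraph_connected 2)

theorem not_isSuperEdgeConnected_of_isLadderPathOrCycle {V : Type u} {G : SimpleGraph V}
    (h : IsLadderPathOrCycle G) : ¬ IsSuperEdgeConnected G := by
  intro hs
  rcases h with ⟨⟨e⟩⟩ | ⟨n, hn, ⟨⟨e⟩⟩ | ⟨⟨e⟩⟩⟩
  · exact not_isSuperEdgeConnected_ladder (hs.of_iso e.symm ladder_connected)
  all_goals obtain ⟨n, rfl⟩ : ∃ m, n = m + 4 := ⟨n - 4, by omega⟩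
  · exact not_isSuperEdgeConnected_pathGraph n (hs.of_iso e.symm (pathGraph_connected _))
  · exact not_isSuperEdgeConnected_cycleGraph n (hs.of_iso e.symm cycleGraph_connected)

/-! ### Graphs without induced H₀ and P₄ -/

/-- The diameter is at most two: along a walk, a path of length three between the ends is always
shortened by a chord. -/
theorem exists_common_neighbor {V : Type u} {G : SimpleGraph V} (hG : G.Connected)
    (hP : ∀ p q r s, G.Adj p q → G.Adj q r → G.Adj r s → G.Adj p r ∨ G.Adj q s ∨ G.Adj p s)
    (x y : V) : x = y ∨ G.Adj x y ∨ ∃ u, G.Adj x u ∧ G.Adj u y := by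
  obtain ⟨p⟩ := hG.preconnected y x
  induction p with
  | nil => exact .inl rfl
  | cons hadj p ih =>
    rcases ih with rfl | h | ⟨u, h1, h2⟩
    · exact .inr (.inl hadj.symm)
    · exact .inr (.inr ⟨_, h, hadj.symm⟩)
    · rcases hP _ _ _ _ h1 h2 hadj.symm with h | h | h
      · exact .inr (.inr ⟨_, h, hadj.symm⟩)
      · exact .inr (.inr ⟨_, h1, h⟩)
      · exact .inr (.inl h)

theorem isC4_of_adj {V : Type u} {G : SimpleGraph V} {a b c d : V} (hab : G.Adj a b)
    (hbc : G.Adj b c) (hcd : G.Adj c d) (hda : G.Adj d a) (hac : ¬ G.Adj a c) (hbd : ¬ G.Adj b d)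
    (hac' : a ≠ c) (hbd' : b ≠ d) (hall : ∀ v, v = a ∨ v = b ∨ v = c ∨ v = d) : IsC4 G := by
  have hbij : Function.Bijective ![a, b, c, d] := by
    constructor
    · intro i j
      have := hab.ne; have := hbc.ne; have := hcd.ne; have := hda.ne
      fin_cases i <;> fin_cases j <;> simp <;> grind
    · intro v
      rcases hall v with rfl | rfl | rfl | rfl
      exacts [⟨0, rfl⟩, ⟨1, rfl⟩, ⟨2, rfl⟩, ⟨3, rfl⟩]
  refine ⟨.symm ⟨Equiv.ofBijective _ hbij, fun {i j} => ?_⟩⟩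
  have e1 : (2 : Fin 4) - 1 = 1 := rfl
  have e2 : (3 : Fin 4) - 2 = 1 := rfl
  have e3 : (0 : Fin 4) - 3 = 1 := rfl
  have e4 : (2 : Fin 4) ≠ 1 := by decide
  fin_cases i <;> fin_cases j <;>
    simp [cycleGraph_adj, hab, hbc, hcd, hda, hac, hbd, hab.symm, hbc.symm, hcd.symm, hda.symm,
      G.adj_comm c a, G.adj_comm d b] <;> decide

/-- If each vertex of `X` has a neighbour across a tight cut, then `X` is a clique, and each of
its vertices has exactly one neighbour across. -/
theorem TightCut.clique_of_forall_exists {V : Type u} [Fintype V] [DecidableEq V]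
    {G : SimpleGraph V} [DecidableRel G.Adj] {X Y : Finset V} (h : TightCut G X Y)
    (hX : ∀ x ∈ X, ∃ y ∈ Y, G.Adj x y) :
    #X ≤ #Y ∧ (∀ x ∈ X, ∀ x' ∈ X, x ≠ x' → G.Adj x x') ∧
      (∀ x ∈ X, ∀ y ∈ Y, ∀ y' ∈ Y, G.Adj x y → G.Adj x y' → y = y') ∧ ∀ v, #X ≤ G.degree v := by
  obtain ⟨x₀, -⟩ := Finset.card_pos.mp (zero_lt_one.trans h.one_lt_left)
  have : Nonempty V := ⟨x₀⟩
  obtain ⟨v, hv⟩ := G.exists_minimal_degree_vertex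
  have hv' : ∀ w, G.degree v ≤ G.degree w := fun w => hv ▸ G.minDegree_le_degree w
  have h1 := h.le_card v hv'
  have h2 := h.symm.le_card v hv'
  have h3 := h.le_degree v
  rw [card_interedges_eq_sum] at h3
  have h4 : ∀ x ∈ X, 1 ≤ #{y ∈ Y | G.Adj x y} := fun x hx => by
    obtain ⟨y, hy, hxy⟩ := hX x hx
    exact Finset.card_pos.mpr ⟨y, by simp [hy, hxy]⟩
  have h5 : ∑ x ∈ X, 1 ≤ ∑ x ∈ X, #{y ∈ Y | G.Adj x y} := Finset.sum_le_sum h4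
  -- Equality throughout |X| ≤ e(X, Y) ≤ δ ≤ |X|; so each vertex sends exactly one edge across, and
  -- its other δ - 1 = |X| - 1 neighbours fill up `X`.
  have h6 : ∑ x ∈ X, 1 = ∑ x ∈ X, #{y ∈ Y | G.Adj x y} := le_antisymm h5 (by simp; omega)
  have h7 := (Finset.sum_eq_sum_iff_of_le h4).mp h6
  have hc : #X = G.degree v := le_antisymm (by rw [← h6] at h3; simpa using h3) h1
  refine ⟨hc ▸ h2, fun x hx x' hx' hne => ?_, fun x hx y hy y' hy' hxy hxy' => ?_, fun w =>
    hc ▸ hv' w⟩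
  · have hd : Disjoint {y ∈ X | G.Adj x y} {y ∈ Y | G.Adj x y} :=
      Finset.disjoint_filter_filter (Finset.disjoint_left.mpr (h.disj · ))
    have hdeg : G.degree x = #{y ∈ X | G.Adj x y} + 1 := by
      rw [h7 x hx, ← Finset.card_union_of_disjoint hd, ← card_neighborFinset_eq_degree]
      congr 1
      ext y
      have := h.cover y
      simp; tauto
    have hsub : {y ∈ X | G.Adj x y} = X.erase x := by
      refine Finset.eq_of_subset_of_card_le (fun y hy => ?_) ?_
      · simp only [Finset.mem_filter, Finset.mem_erase] at hy ⊢
        exact ⟨hy.2.ne', hy.1⟩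
      · rw [Finset.card_erase_of_mem hx]
        have := hv' x
        omega
    have : x' ∈ X.erase x := by simp [hx', hne.symm]
    rw [← hsub] at this
    exact (Finset.mem_filter.mp this).2
  · exact Finset.card_le_one.mp (h7 x hx).ge y (by simp [hy, hxy]) y' (by simp [hy', hxy'])

theorem isC4_of_tightCut_of_forall_exists {V : Type u} [Fintype V] [DecidableEq V]
    {G : SimpleGraph V} [DecidableRel G.Adj] (hG : G.Connected)
    (hP : ∀ p q r s, G.Adj p q → G.Adj q r → G.Adj r s → G.Adj p r ∨ G.Adj q s ∨ G.Adj p s)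
    (hH : ∀ c a b d e, G.Adj c a → G.Adj c b → G.Adj a b → G.Adj c d → G.Adj c e → G.Adj d e →
      G.Adj a d ∨ G.Adj a e ∨ G.Adj b d ∨ G.Adj b e)
    {X Y : Finset V} (h : TightCut G X Y) (hX : ∀ x ∈ X, ∃ y ∈ Y, G.Adj x y) : IsC4 G := by
  obtain ⟨hXY, hcl, huniq, hdeg⟩ := h.clique_of_forall_exists hX
  have hdiam := exists_common_neighbor hG hP
  obtain ⟨x₁, hx₁, x₂, hx₂, hne⟩ := Finset.one_lt_card.mp h.one_lt_left
  have hX2 := h.one_lt_left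
  by_cases hsame : ∃ y ∈ Y, ∀ x ∈ X, G.Adj x y
  -- If all edges across end in `y`, diameter two makes `y` adjacent to the rest of `Y`. An edge
  -- `zz'` in `Y` avoiding `y` then gives an H₀ with centre `y` and triangles `y x₁ x₂`, `y z z'`.
  · exfalso
    obtain ⟨y, hy, hxy⟩ := hsame
    have hno : ∀ x ∈ X, ∀ z ∈ Y, z ≠ y → ¬ G.Adj x z := fun x hx z hz hzy hxz =>
      hzy (huniq x hx z hz y hy hxz (hxy x hx))
    have hyz : ∀ z ∈ Y, z ≠ y → G.Adj y z := by
      intro z hz hzy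
      rcases hdiam x₁ z with rfl | h' | ⟨u, hu, huz⟩
      · exact absurd hz (h.disj _ hx₁)
      · exact absurd h' (hno x₁ hx₁ z hz hzy)
      · rcases h.cover u with hu' | hu'
        · exact absurd huz (hno u hu' z hz hzy)
        · rwa [← huniq x₁ hx₁ u hu' y hy hu (hxy x₁ hx₁)]
    obtain ⟨z, hz, hzy⟩ := Finset.exists_mem_ne h.one_lt_right y
    have hzd : 1 < #(G.neighborFinset z) := by
      rw [card_neighborFinset_eq_degree]; exact hX2.trans_le (hdeg z)
    obtain ⟨z', hz', hzy'⟩ := Finset.exists_mem_ne hzd y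
    rw [mem_neighborFinset] at hz'
    have hz'Y : z' ∈ Y := (h.cover z').resolve_left fun hX' => hno z' hX' z hz hzy hz'.symm
    have := hH y x₁ x₂ z z' (hxy _ hx₁).symm (hxy _ hx₂).symm (hcl _ hx₁ _ hx₂ hne)
      (hyz z hz hzy) (hyz z' hz'Y hzy') hz'
    have := hno x₁ hx₁ z hz hzy
    have := hno x₂ hx₂ z hz hzy
    have := hno x₁ hx₁ z' hz'Y hzy'
    have := hno x₂ hx₂ z' hz'Y hzy'
    tauto
  obtain ⟨y₁, hy₁, hxy₁⟩ := hX x₁ hx₁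
  push Not at hsame
  obtain ⟨x₂, hx₂, hx₂y₁⟩ := hsame y₁ hy₁
  obtain ⟨y₂, hy₂, hxy₂⟩ := hX x₂ hx₂
  have hne : x₁ ≠ x₂ := fun h => hx₂y₁ (h ▸ hxy₁)
  have hyne : y₁ ≠ y₂ := fun h => hx₂y₁ (h ▸ hxy₂)
  -- Distinct partners of vertices of the clique are adjacent, else `y x x' y'` is an induced P₄.
  have hadj : ∀ x ∈ X, ∀ x' ∈ X, ∀ y ∈ Y, ∀ y' ∈ Y, G.Adj x y → G.Adj x' y' → y ≠ y' →
      G.Adj y y' := by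
    intro x hx x' hx' y hy y' hy' hxy hxy' hyy
    have hxx : x ≠ x' := by rintro rfl; exact hyy (huniq x hx y hy y' hy' hxy hxy')
    rcases hP y x x' y' hxy.symm (hcl x hx x' hx' hxx) hxy' with h1 | h1 | h1
    · exact absurd (huniq x' hx' y hy y' hy' h1.symm hxy') hyy
    · exact absurd (huniq x hx y hy y' hy' hxy h1) hyy
    · exact h1
  have hx₁y₂ : ¬ G.Adj x₁ y₂ := fun h' => hyne (huniq x₁ hx₁ y₁ hy₁ y₂ hy₂ hxy₁ h')
  have hy12 := hadj x₁ hx₁ x₂ hx₂ y₁ hy₁ y₂ hy₂ hxy₁ hxy₂ hyne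
  have hno : ∀ y ∈ Y, y ≠ y₁ → y ≠ y₂ → ¬ G.Adj y₁ y := by
    intro y hy hyy₁ hyy₂ hy₁y
    have hn1 : ¬ G.Adj x₁ y := fun h' => hyy₁ (huniq x₁ hx₁ y hy y₁ hy₁ h' hxy₁)
    have hn2 : ¬ G.Adj x₂ y := fun h' => hyy₂ (huniq x₂ hx₂ y hy y₂ hy₂ h' hxy₂)
    have := hP x₂ x₁ y₁ y (hcl _ hx₂ _ hx₁ hne.symm) hxy₁ hy₁y
    tauto
  -- A further vertex `y` would be within distance two of `x₁`, hence either the partner of a vertex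
  -- of `X` or adjacent to `y₁`; both make it a third neighbour of `y₁`, which `hno` forbids.
  have hYall : ∀ y ∈ Y, y = y₁ ∨ y = y₂ := by
    intro y hy
    by_contra! hc
    have hn := hno y hy hc.1 hc.2
    rcases hdiam x₁ y with rfl | h' | ⟨u, hu, huy⟩
    · exact h.disj _ hx₁ hy
    · exact hc.1 (huniq x₁ hx₁ y hy y₁ hy₁ h' hxy₁)
    · rcases h.cover u with hu' | hu'
      · exact hn (hadj x₁ hx₁ u hu' y₁ hy₁ y hy hxy₁ huy hc.1.symm)
      · exact hn (huniq x₁ hx₁ u hu' y₁ hy₁ hu hxy₁ ▸ huy)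
  have hYc : #Y ≤ 2 := (Finset.card_le_card (t := {y₁, y₂}) fun y hy => by
    simpa using hYall y hy).trans Finset.card_le_two
  have hXeq : X = {x₁, x₂} := (Finset.eq_of_subset_of_card_le (by
    intro; simp; rintro (rfl | rfl) <;> assumption) (by
    rw [Finset.card_pair hne]; omega)).symm
  refine isC4_of_adj hxy₁.symm (hcl x₁ hx₁ x₂ hx₂ hne) hxy₂ hy12.symm (fun h' => hx₂y₁ h'.symm)
    hx₁y₂ (fun h' => h.disj x₂ hx₂ (h' ▸ hy₁)) (fun h' => h.disj x₁ hx₁ (h' ▸ hy₂)) fun v => ?_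
  rcases h.cover v with hv | hv
  · rw [hXeq] at hv; simp at hv; tauto
  · have := hYall v hv; tauto

/-- A connected `{H₀, P₄}`-free graph that is not super-edge-connected is `C₄`. -/
theorem isC4_of_not_isSuperEdgeConnected {V : Type u} [Finite V] {G : SimpleGraph V}
    (hG : G.Connected)
    (hP : ∀ p q r s, G.Adj p q → G.Adj q r → G.Adj r s → G.Adj p r ∨ G.Adj q s ∨ G.Adj p s)
    (hH : ∀ c a b d e, G.Adj c a → G.Adj c b → G.Adj a b → G.Adj c d → G.Adj c e → G.Adj d e →
      G.Adj a d ∨ G.Adj a e ∨ G.Adj b d ∨ G.Adj b e)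
    (hs : ¬ IsSuperEdgeConnected G) : IsC4 G := by
  classical
  have := Fintype.ofFinite V
  obtain ⟨X, Y, h⟩ := exists_tightCut hG hs
  by_cases hX : ∀ x ∈ X, ∃ y ∈ Y, G.Adj x y
  · exact isC4_of_tightCut_of_forall_exists hG hP hH h hX
  -- If `x` has no neighbour across, its common neighbour with any `y` in `Y` lies in `X`, so the
  -- roles of the sides can be exchanged.
  refine isC4_of_tightCut_of_forall_exists hG hP hH h.symm fun y hy => ?_
  push Not at hX
  obtain ⟨x, hx, hxY⟩ := hX
  rcases exists_common_neighbor hG hP x y with rfl | h' | ⟨u, hxu, huy⟩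
  · exact absurd hy (h.disj _ hx)
  · exact absurd h' (hxY y hy)
  · exact ⟨u, (h.cover u).resolve_right fun hu => hxY u hu hxu, huy.symm⟩

/-! ### Graphs with a triangle and no induced Z₁ -/

/-- A connected graph without induced `Z₁` that has a triangle is complete multipartite. -/
theorem adj_or_adj_of_triangle {V : Type u} {G : SimpleGraph V} (hG : G.Connected)
    (hZ : ∀ a b c d, G.Adj a b → G.Adj a c → G.Adj b c → G.Adj a d → b = d ∨ c = d ∨
      G.Adj b d ∨ G.Adj c d)
    {x y z : V} (hxy : G.Adj x y) (hxz : G.Adj x z) (hyz : G.Adj y z)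
    {a b : V} (hab : G.Adj a b) (c : V) : G.Adj c a ∨ G.Adj c b := by
  -- Lying on a triangle passes to neighbours; hence every vertex, and then every edge, lies on one.
  have hvert : ∀ v, ∃ p q, G.Adj v p ∧ G.Adj v q ∧ G.Adj p q := by
    intro v
    obtain ⟨w⟩ := hG.preconnected v x
    induction w with
    | nil => exact ⟨y, z, hxy, hxz, hyz⟩
    | cons hadj _ ih =>
      obtain ⟨p, q, h1, h2, h3⟩ := ih hxy hxz
      rcases hZ _ p q _ h1 h2 h3 hadj.symm with rfl | rfl | h | h
      · exact ⟨_, q, hadj, h3, h2⟩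
      · exact ⟨_, p, hadj, h3.symm, h1⟩
      · exact ⟨_, p, hadj, h.symm, h1⟩
      · exact ⟨_, q, hadj, h.symm, h2⟩
  obtain ⟨d, had, hbd⟩ : ∃ d, G.Adj a d ∧ G.Adj b d := by
    obtain ⟨p, q, h1, h2, h3⟩ := hvert a
    rcases hZ _ p q _ h1 h2 h3 hab with rfl | rfl | h | h
    · exact ⟨q, h2, h3⟩
    · exact ⟨p, h1, h3.symm⟩
    · exact ⟨p, h1, h.symm⟩
    · exact ⟨q, h2, h.symm⟩
  -- `D c`: the vertex is adjacent to at least two corners of the triangle `abd`. One adjacent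
  -- corner already implies two, and the property spreads along edges; two corners always include
  -- `a` or `b`.
  set D : V → Prop := fun c =>
    (G.Adj c a ∧ G.Adj c b) ∨ (G.Adj c a ∧ G.Adj c d) ∨ (G.Adj c b ∧ G.Adj c d) with hD
  suffices D c by simp only [hD] at this; tauto
  have hDa : D a := .inr (.inr ⟨hab, had⟩)
  have hDb : D b := .inr (.inl ⟨hab.symm, hbd⟩)
  have hDd : D d := .inl ⟨had.symm, hbd.symm⟩
  have ha : ∀ w, G.Adj a w → D w := fun w hw => by
    rcases hZ a b d w hab had hbd hw with rfl | rfl | h | h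
    exacts [hDb, hDd, .inl ⟨hw.symm, h.symm⟩, .inr (.inl ⟨hw.symm, h.symm⟩)]
  have hb : ∀ w, G.Adj b w → D w := fun w hw => by
    rcases hZ b a d w hab.symm hbd had hw with rfl | rfl | h | h
    exacts [hDa, hDd, .inl ⟨h.symm, hw.symm⟩, .inr (.inr ⟨hw.symm, h.symm⟩)]
  have hd : ∀ w, G.Adj d w → D w := fun w hw => by
    rcases hZ d a b w had.symm hbd.symm hab hw with rfl | rfl | h | h
    exacts [hDa, hDb, .inr (.inl ⟨h.symm, hw.symm⟩), .inr (.inr ⟨h.symm, hw.symm⟩)]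
  have hstep : ∀ w w', G.Adj w w' → D w → D w' := by
    rintro w w' hww' (⟨h1, h2⟩ | ⟨h1, h2⟩ | ⟨h1, h2⟩)
    · rcases hZ w a b w' h1 h2 hab hww' with rfl | rfl | h | h
      exacts [hDa, hDb, ha _ h, hb _ h]
    · rcases hZ w a d w' h1 h2 had hww' with rfl | rfl | h | h
      exacts [hDa, hDd, ha _ h, hd _ h]
    · rcases hZ w b d w' h1 h2 hbd hww' with rfl | rfl | h | h
      exacts [hDb, hDd, hb _ h, hd _ h]
  have hwalk : ∀ u v, G.Walk u v → D u → D v := by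
    intro u v p
    induction p with
    | nil => exact id
    | cons hadj _ ih => exact fun hu => ih (hstep _ _ hadj hu)
  exact (hG.preconnected a c).elim fun p => hwalk _ _ p hDa

/-! ### Graphs of maximum degree two -/

theorem cycleGraph_adj_iff_of_lt {n : ℕ} {i j : Fin n} (hij : i < j) :
    (cycleGraph n).Adj i j ↔ i.val + 1 = j.val ∨ i.val = 0 ∧ j.val + 1 = n := by
  rw [cycleGraph_adj', Fin.coe_sub_iff_lt.mpr hij, Fin.coe_sub_iff_le.mpr hij.le]
  have := j.isLt
  have : i.val < j.val := hij
  omega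

/-- A connected graph of maximum degree at most two is a path or a cycle. -/
theorem exists_iso_path_or_cycle {V : Type u} [Finite V] {G : SimpleGraph V} (hG : G.Connected)
    (hdeg : ∀ v a b c, G.Adj v a → G.Adj v b → G.Adj v c → a = b ∨ a = c ∨ b = c)
    (hcard : 3 ≤ Nat.card V) :
    Nonempty (G ≃g pathGraph (Nat.card V)) ∨ Nonempty (G ≃g cycleGraph (Nat.card V)) := by
  classical
  have := Fintype.ofFinite V
  have := hG.nonempty
  obtain ⟨u, v, p, hp, hmax⟩ := Walk.exists_isPath_forall_isPath_length_le_length G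
  set m := p.length with hm
  set f := p.getVert with hf
  have hinj : ∀ i j, i ≤ m → j ≤ m → f i = f j → i = j := fun i j hi hj h =>
    hp.getVert_injOn hi hj h
  have hadj : ∀ i < m, G.Adj (f i) (f (i + 1)) := fun i hi => p.adj_getVert_succ hi
  have hu : f 0 = u := p.getVert_zero
  have hv : f m = v := p.getVert_length
  have hsup : ∀ w, w ∈ p.support → ∃ i ≤ m, f i = w := fun w hw => by
    obtain ⟨i, h1, h2⟩ := Walk.mem_support_iff_exists_getVert.mp hw
    exact ⟨i, h2, h1⟩
  have hendu : ∀ w, G.Adj u w → ∃ i ≤ m, f i = w := fun w hw => by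
    refine hsup w (by_contra fun hn => ?_)
    have := hmax _ _ (.cons hw.symm p) (hp.cons hn)
    simp at this
    omega
  have hendv : ∀ w, G.Adj v w → ∃ i ≤ m, f i = w := fun w hw => by
    refine hsup w (by_contra fun hn => ?_)
    have := hmax _ _ (.cons hw.symm p.reverse) (hp.reverse.cons (by simpa))
    simp at this
    omega
  have hmid : ∀ i, 0 < i → i < m → ∀ w, G.Adj (f i) w → w = f (i - 1) ∨ w = f (i + 1) := by
    intro i hi him w hw
    have h1 := hadj (i - 1) (by omega)
    rw [Nat.sub_add_cancel hi] at h1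
    rcases hdeg _ _ _ _ h1.symm (hadj i him) hw with h | h | h
    · have := hinj _ _ (by omega) (by omega) h
      omega
    · exact .inl h.symm
    · exact .inr h.symm
  -- A longest path is closed under adjacency: its ends have no neighbours outside by maximality,
  -- and its inner vertices have used up their degree. So it spans the graph.
  have hstep : ∀ i ≤ m, ∀ w, G.Adj (f i) w → ∃ j ≤ m, f j = w := by
    intro i hi w hw
    rcases Nat.eq_zero_or_pos i with rfl | h0
    · exact hendu w (hu ▸ hw)
    rcases hi.eq_or_lt with rfl | him
    · exact hendv w (hv ▸ hw)
    rcases hmid i h0 him w hw with rfl | rfl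
    exacts [⟨_, by omega, rfl⟩, ⟨_, by omega, rfl⟩]
  have hwalk : ∀ a b, G.Walk a b → (∃ i ≤ m, f i = a) → ∃ i ≤ m, f i = b := by
    intro a b q
    induction q with
    | nil => exact id
    | cons had _ ih =>
      rintro ⟨i, hi, rfl⟩
      exact ih (hstep i hi _ had)
  have hcov : ∀ w, ∃ i ≤ m, f i = w := fun w =>
    (hG.preconnected u w).elim fun q => hwalk _ _ q ⟨0, Nat.zero_le _, hu⟩
  have hbij : Function.Bijective fun i : Fin (m + 1) => f i := by
    refine ⟨fun i j h => Fin.ext (hinj _ _ (by omega) (by omega) h), fun w => ?_⟩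
    obtain ⟨i, hi, rfl⟩ := hcov w
    exact ⟨⟨i, by omega⟩, rfl⟩
  have hc : Nat.card V = m + 1 := by
    rw [← Nat.card_congr (Equiv.ofBijective _ hbij), Nat.card_fin]
  -- The only possible chord joins the two ends; it decides between path and cycle.
  have hij : ∀ i j, i < j → j ≤ m → G.Adj (f i) (f j) → j = i + 1 ∨ i = 0 ∧ j = m := by
    intro i j hlt hjm h
    by_cases hi : 0 < i
    · rcases hmid i hi (by omega) _ h with h' | h' <;>
        have := hinj _ _ (by omega) (by omega) h' <;> omega
    · obtain rfl : i = 0 := by omega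
      by_cases hj : j < m
      · rcases hmid j hlt hj _ h.symm with h' | h' <;>
          have := hinj _ _ (by omega) (by omega) h' <;> omega
      · omega
  rw [hc] at hcard ⊢
  by_cases huv : G.Adj (f 0) (f m)
  · refine .inr ⟨.symm ⟨Equiv.ofBijective _ hbij, fun {i j} => ?_⟩⟩
    have key : ∀ i j : Fin (m + 1), i < j →
        (G.Adj (f i) (f j) ↔ (cycleGraph (m + 1)).Adj i j) := fun i j hlt => by
      rw [cycleGraph_adj_iff_of_lt hlt]
      refine ⟨fun h => ?_, ?_⟩
      · have := hij i j hlt (by omega) h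
        omega
      · rintro (h | ⟨h, h'⟩)
        · rw [← h]; exact hadj _ (by omega)
        · rw [h, show j.val = m by omega]; exact huv
    rcases lt_trichotomy i j with h | rfl | h
    · exact key i j h
    · simp
    · rw [G.adj_comm, (cycleGraph _).adj_comm]; exact key j i h
  · refine .inl ⟨.symm ⟨Equiv.ofBijective _ hbij, fun {i j} => ?_⟩⟩
    have key : ∀ i j : Fin (m + 1), i < j →
        (G.Adj (f i) (f j) ↔ (pathGraph (m + 1)).Adj i j) := fun i j hlt => by
      rw [pathGraph_adj]
      refine ⟨fun h => ?_, ?_⟩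
      · rcases hij i j hlt (by omega) h with h' | ⟨h1, h2⟩
        · exact .inl h'.symm
        · rw [h1, h2] at h; exact absurd h huv
      · rintro (h | h)
        · rw [← h]; exact hadj _ (by omega)
        · have : i.val < j.val := hlt
          omega
    rcases lt_trichotomy i j with h | rfl | h
    · exact key i j h
    · simp
    · rw [G.adj_comm, (pathGraph _).adj_comm]; exact key j i h

/-! ### Triangle-free graphs without induced T₁₁₂ -/

/-- A bipartition `P, Pᶜ` in which every vertex is adjacent to all but at most one vertex of the
other side. -/
structure IsNearlyComplete {V : Type u} (G : SimpleGraph V) (P : Set V) : Prop where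
  bip : ∀ x y, G.Adj x y → (x ∈ P ↔ y ∉ P)
  left : ∀ x ∈ P, ∀ y ∉ P, ∀ y' ∉ P, ¬ G.Adj x y → ¬ G.Adj x y' → y = y'
  right : ∀ y ∉ P, ∀ x ∈ P, ∀ x' ∈ P, ¬ G.Adj x y → ¬ G.Adj x' y → x = x'

/-- A connected graph without triangles and induced `T₁₁₂` that has a vertex of degree three is
complete bipartite up to a matching. -/
theorem exists_isNearlyComplete {V : Type u} {G : SimpleGraph V} (hG : G.Connected)
    (hT : ∀ a b c, G.Adj a b → G.Adj b c → ¬ G.Adj a c)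
    (hF : ∀ c a b d e, G.Adj c a → G.Adj c b → G.Adj c d → G.Adj d e → a ≠ b → a ≠ d → b ≠ d →
      e ≠ c → G.Adj e a ∨ G.Adj e b)
    {v a₁ a₂ a₃ : V} (h₁ : G.Adj v a₁) (h₂ : G.Adj v a₂) (h₃ : G.Adj v a₃) (h12 : a₁ ≠ a₂)
    (h13 : a₁ ≠ a₃) (h23 : a₂ ≠ a₃) :
    ∃ P : Set V, IsNearlyComplete G P ∧ v ∈ P := by
  -- The vertices at distance zero or two from `v`.
  set P : Set V := {w | ∃ u, G.Adj v u ∧ G.Adj u w} with hP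
  have hvP : v ∈ P := ⟨a₁, h₁, h₁.symm⟩
  have hAP : ∀ a, G.Adj v a → a ∉ P := fun a ha ⟨u, hvu, hua⟩ => hT v u a hvu hua ha
  -- a vertex at distance two misses at most one neighbour of `v`
  have hB : ∀ w ∈ P, ∀ a a', G.Adj v a → G.Adj v a' → a ≠ a' → G.Adj w a ∨ G.Adj w a' := by
    rintro w ⟨u, hvu, huw⟩ a a' ha ha' hne
    by_cases hwv : w = v
    · exact .inl (hwv ▸ ha)
    by_cases hua : a = u
    · exact .inl (hua ▸ huw.symm)
    by_cases hua' : a' = u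
    · exact .inr (hua' ▸ huw.symm)
    exact hF v a a' u w ha ha' hvu huw hne hua hua' hwv
  -- Each of `w`, `w'` misses at most one of the three vertices `aᵢ`, so some `aᵢ` is missed by
  -- neither.
  have hcommon : ∀ w ∈ P, ∀ w' ∈ P, ∃ a, G.Adj v a ∧ G.Adj w a ∧ G.Adj w' a := by
    intro w hw w' hw'
    have := hB w hw a₁ a₂ h₁ h₂ h12
    have := hB w hw a₁ a₃ h₁ h₃ h13
    have := hB w hw a₂ a₃ h₂ h₃ h23
    have := hB w' hw' a₁ a₂ h₁ h₂ h12
    have := hB w' hw' a₁ a₃ h₁ h₃ h13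
    have := hB w' hw' a₂ a₃ h₂ h₃ h23
    by_cases h1 : G.Adj w a₁ ∧ G.Adj w' a₁
    · exact ⟨a₁, h₁, h1⟩
    by_cases h2 : G.Adj w a₂ ∧ G.Adj w' a₂
    · exact ⟨a₂, h₂, h2⟩
    exact ⟨a₃, h₃, by tauto⟩
  have hPind : ∀ w ∈ P, ∀ w' ∈ P, ¬ G.Adj w w' := fun w hw w' hw' hww' => by
    obtain ⟨a, -, h1, h2⟩ := hcommon w hw w' hw'
    exact hT w w' a hww' h2 h1
  -- a vertex at distance three is adjacent to all vertices at distance two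
  have hC : ∀ c, ¬ G.Adj v c → c ∉ P → ∀ w' ∈ P, G.Adj c w' → ∀ w ∈ P, w ≠ v → G.Adj c w := by
    intro c hvc hcP w' hw' hcw' w hw hwv
    by_contra hcw
    obtain ⟨a, hva, hwa, hwa'⟩ := hcommon w hw w' hw'
    have hw'v : w' ≠ v := by rintro rfl; exact hvc hcw'.symm
    rcases hF a v w w' c hva.symm hwa.symm hwa'.symm hcw'.symm hwv.symm hw'v.symm
      (by rintro rfl; exact hcw hcw') (by rintro rfl; exact hvc hva) with h | h
    · exact hvc h.symm
    · exact hcw h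
  have hCuniq : ∀ c c', ¬ G.Adj v c → ¬ G.Adj v c' → ∀ w ∈ P, G.Adj c w → G.Adj c' w →
      c = c' := by
    intro c c' hvc hvc' w hw hcw hcw'
    by_contra hne
    obtain ⟨a, hva, hwa, -⟩ := hcommon w hw w hw
    rcases hF w c c' a v hcw.symm hcw'.symm hwa hva.symm hne (by rintro rfl; exact hvc hva)
      (by rintro rfl; exact hvc' hva) (by rintro rfl; exact hvc hcw.symm) with h | h
    exacts [hvc h, hvc' h]
  -- No vertex has distance four from `v`: with `c` at distance three and `w` in `P` next to it, a
  -- T₁₁₂ centred at `w` has two neighbours of `v` as short legs and `c`, `t` as the long one.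
  have hstep : ∀ x y, G.Adj x y → (x ∈ P ∨ ∃ w ∈ P, G.Adj x w) → y ∈ P ∨ ∃ w ∈ P, G.Adj y w := by
    rintro c t hct (hc | ⟨w, hw, hcw⟩)
    · exact .inr ⟨c, hc, hct.symm⟩
    left
    by_cases hvc : G.Adj v c
    · exact ⟨c, hvc, hct⟩
    by_cases htw : t = w
    · exact htw ▸ hw
    have hwc : w ≠ v := by rintro rfl; exact hvc hcw.symm
    have key : ∀ a a', G.Adj v a → G.Adj v a' → a ≠ a' → G.Adj w a → G.Adj w a' → t ∈ P := by
      intro a a' ha ha' hne hwa hwa'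
      rcases hF w a a' c t hwa hwa' hcw.symm hct hne (by rintro rfl; exact hvc ha)
        (by rintro rfl; exact hvc ha') htw with h | h
      exacts [⟨a, ha, h.symm⟩, ⟨a', ha', h.symm⟩]
    have h5 := hB w hw a₁ a₂ h₁ h₂ h12
    have h6 := hB w hw a₁ a₃ h₁ h₃ h13
    have h7 := hB w hw a₂ a₃ h₂ h₃ h23
    by_cases h8 : G.Adj w a₁
    · rcases h7 with h7 | h7
      exacts [key _ _ h₁ h₂ h12 h8 h7, key _ _ h₁ h₃ h13 h8 h7]
    · exact key _ _ h₂ h₃ h23 (h5.resolve_left h8) (h6.resolve_left h8)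
  have hcov : ∀ y, y ∈ P ∨ ∃ w ∈ P, G.Adj y w := by
    have hwalk : ∀ x y, G.Walk x y → (x ∈ P ∨ ∃ w ∈ P, G.Adj x w) →
        y ∈ P ∨ ∃ w ∈ P, G.Adj y w := by
      intro x y q
      induction q with
      | nil => exact id
      | cons had _ ih => exact fun h => ih (hstep _ _ had h)
    exact fun y => (hG.preconnected v y).elim fun q => hwalk _ _ q (.inl hvP)
  have hcov' : ∀ y ∉ P, ∃ w ∈ P, G.Adj y w := fun y hy => (hcov y).resolve_left hy
  refine ⟨P, ⟨?_, ?_, ?_⟩, hvP⟩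
  · refine fun x y hxy => ⟨fun hx hy => hPind x hx y hy hxy, fun hy => by_contra fun hx => ?_⟩
    -- An edge outside `P` has both ends at distance three from `v`; they share a neighbour in `P`,
    -- which `hCuniq` excludes.
    have hvx : ¬ G.Adj v x := fun h => hy ⟨x, h, hxy⟩
    have hvy : ¬ G.Adj v y := fun h => hx ⟨y, h, hxy.symm⟩
    obtain ⟨w, hw, hxw⟩ := hcov' x hx
    obtain ⟨w', hw', hyw'⟩ := hcov' y hy
    have := hC y hvy hy w' hw' hyw' w hw (by rintro rfl; exact hvx hxw.symm)
    exact hxy.ne (hCuniq x y hvx hvy w hw hxw this)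
  · intro x hx y hy y' hy' hxy hxy'
    obtain ⟨w, hw, hyw⟩ := hcov' y hy
    obtain ⟨w', hw', hyw'⟩ := hcov' y' hy'
    by_cases hvy : G.Adj v y <;> by_cases hvy' : G.Adj v y'
    · by_contra hne
      rcases hB x hx y y' hvy hvy' hne with h | h
      exacts [hxy h, hxy' h]
    · have hxv : x ≠ v := by rintro rfl; exact hxy hvy
      exact absurd (hC y' hvy' hy' w' hw' hyw' x hx hxv).symm hxy'
    · have hxv : x ≠ v := by rintro rfl; exact hxy' hvy'
      exact absurd (hC y hvy hy w hw hyw x hx hxv).symm hxy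
    · have hwv : w ≠ v := by rintro rfl; exact hvy hyw.symm
      exact hCuniq y y' hvy hvy' w hw hyw (hC y' hvy' hy' w' hw' hyw' w hw hwv)
  · intro y hy x hx x' hx' hxy hxy'
    obtain ⟨w, hw, hyw⟩ := hcov' y hy
    by_cases hvy : G.Adj v y
    · by_contra hne
      have hxv : x ≠ v := by rintro rfl; exact hxy hvy
      have hxv' : x' ≠ v := by rintro rfl; exact hxy' hvy
      obtain ⟨a, hva, hxa, hxa'⟩ := hcommon x hx x' hx'
      rcases hF a x x' v y hxa.symm hxa'.symm hva.symm hvy hne hxv hxv'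
        (by rintro rfl; exact hxy hxa) with h | h
      exacts [hxy h.symm, hxy' h.symm]
    · have hx : x = v := by
        by_contra hxv
        exact hxy (hC y hvy hy w hw hyw x hx hxv).symm
      have hx' : x' = v := by
        by_contra hxv
        exact hxy' (hC y hvy hy w hw hyw x' hx' hxv).symm
      rw [hx, hx']

/-! ### Tight cuts of nearly complete bipartite graphs -/

/-- An independent side would send out at least deg a + deg b > deg a edges, for any two of its
vertices. -/
theorem TightCut.exists_adj {V : Type u} [Fintype V] [DecidableEq V] {G : SimpleGraph V}
    [DecidableRel G.Adj] (hG : G.Connected) {X Y : Finset V} (h : TightCut G X Y) :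
    ∃ x ∈ X, ∃ x' ∈ X, G.Adj x x' := by
  by_contra! hn
  have h1 := sum_degree_side h
  have h2 : ∑ x ∈ X, #{y ∈ X | G.Adj x y} = 0 := Finset.sum_eq_zero fun x hx => by
    rw [Finset.card_eq_zero, Finset.filter_eq_empty_iff]
    exact fun y hy => hn x hx y hy
  obtain ⟨a, ha, b, hb, hab⟩ := Finset.one_lt_card.mp h.one_lt_left
  have h3 : G.degree a + G.degree b ≤ ∑ x ∈ X, G.degree x := by
    rw [← Finset.sum_pair (f := (G.degree ·)) hab]
    exact Finset.sum_le_sum_of_subset (by intro; simp; rintro (rfl | rfl) <;> assumption)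
  have h4 := h.le_degree a
  have : Nontrivial V := ⟨a, b, hab⟩
  have := hG.preconnected.degree_pos_of_nontrivial b
  omega

/-- The numbers of vertices in the four quarters of a tight cut of a nearly complete bipartite
graph: the side `Q` has three vertices. `e₁, e₂` count edges across, `m₁, m₂` missing edges. -/
theorem card_right_eq_three {p₁ p₂ q₁ q₂ e₁ e₂ m₁ m₂ : ℕ} (hp₁ : 0 < p₁) (hp₂ : 0 < p₂)
    (hq₁ : 0 < q₁) (hq₂ : 0 < q₂) (hq : 3 ≤ q₁ + q₂) (h₁ : e₁ + m₁ = p₁ * q₂)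
    (h₂ : e₂ + m₂ = p₂ * q₁) (hm₁ : m₁ ≤ p₁) (hm₁' : m₁ ≤ q₂) (hm₂ : m₂ ≤ p₂) (hm₂' : m₂ ≤ q₁)
    (hp : e₁ + e₂ + 1 ≤ p₁ + p₂) : q₁ + q₂ = 3 := by
  by_contra hne
  rcases Nat.lt_or_ge 1 q₁ with h | h
  · rcases Nat.lt_or_ge 1 q₂ with h' | h'
    -- If both `q₁, q₂ ≥ 2`, then `e₁ ≥ 2p₁ - m₁ ≥ p₁` and likewise `e₂ ≥ p₂`, too many edges
    -- across.
    · nlinarith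
    · obtain rfl : q₂ = 1 := by omega
      have := Nat.mul_le_mul_left p₂ (show 3 ≤ q₁ by omega)
      omega
  · obtain rfl : q₁ = 1 := by omega
    have := Nat.mul_le_mul_left p₁ (show 3 ≤ q₂ by omega)
    omega

/-- For `q₁ = 1`, `q₂ = 2`: `hq'` gives 2p₁ + p₂ ≤ 2 + m₁ + m₂, so `hm` forces p₁ = 1, then `hp`
forces m₁ = m₂ = 1 and p₂ = 2. The bound `hm` says that some vertex on the side `P` misses nothing.
-/
theorem card_left_eq_three {p₁ p₂ q₁ q₂ e₁ e₂ m₁ m₂ : ℕ} (hp₁ : 0 < p₁) (hp₂ : 0 < p₂)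
    (hq₁ : 0 < q₁) (hq₂ : 0 < q₂) (hq : q₁ + q₂ = 3) (h₁ : e₁ + m₁ = p₁ * q₂)
    (h₂ : e₂ + m₂ = p₂ * q₁) (hm₁ : m₁ ≤ p₁) (hm₁' : m₁ ≤ q₂) (hm₂ : m₂ ≤ p₂) (hm₂' : m₂ ≤ q₁)
    (hm : m₁ + m₂ + 1 ≤ p₁ + p₂)
    (hp : e₁ + e₂ + 1 ≤ p₁ + p₂) (hq' : e₁ + e₂ + 1 ≤ q₁ + q₂) :
    p₁ + p₂ = 3 ∧ 0 < m₁ ∧ 0 < m₂ := by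
  obtain ⟨rfl, rfl⟩ | ⟨rfl, rfl⟩ : q₁ = 1 ∧ q₂ = 2 ∨ q₁ = 2 ∧ q₂ = 1 := by omega
  all_goals omega

/-- K₃,₃ minus the disjoint edges `xy`, `x'y'` is the ladder with rows `x z x'` and `y' v y`. -/
theorem isLadder_of_adj {V : Type u} {G : SimpleGraph V} {x v x' y z y' : V}
    (hxz : G.Adj x z) (hxy' : G.Adj x y') (hx'z : G.Adj x' z) (hx'y : G.Adj x' y)
    (hvy : G.Adj v y) (hvz : G.Adj v z) (hvy' : G.Adj v y') (hxy : ¬ G.Adj x y)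
    (hx'y' : ¬ G.Adj x' y') {P : Set V} (hP : ∀ a b, G.Adj a b → (a ∈ P ↔ b ∉ P))
    (hx : x ∈ P) (hv : v ∈ P) (hx' : x' ∈ P) (hy : y ∉ P) (hz : z ∉ P) (hy' : y' ∉ P)
    (hxx' : x ≠ x') (hyy' : y ≠ y')
    (hall : ∀ w, w = x ∨ w = v ∨ w = x' ∨ w = y ∨ w = z ∨ w = y') :
    Nonempty (G ≃g (pathGraph 2).boxProd (pathGraph 3)) := by
  set f : Fin 2 × Fin 3 → V := fun i => ![![x, z, x'], ![y', v, y]] i.1 i.2 with hf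
  have hvx : v ≠ x := by rintro rfl; exact hxy hvy
  have hvx' : v ≠ x' := by rintro rfl; exact hx'y' hvy'
  have hzy : z ≠ y := by rintro rfl; exact hxy hxz
  have hzy' : z ≠ y' := by rintro rfl; exact hx'y' hx'z
  have hPn : ∀ a ∈ P, ∀ b ∈ P, ¬ G.Adj a b := fun a ha b hb h => (hP a b h).mp ha hb
  have hQn : ∀ a ∉ P, ∀ b ∉ P, ¬ G.Adj a b := fun a ha b hb h => ha ((hP a b h).mpr hb)
  have hne : ∀ a ∈ P, ∀ b ∉ P, a ≠ b := by rintro a ha b hb rfl; exact hb ha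
  have hbij : Function.Bijective f := by
    constructor
    · rintro ⟨i, j⟩ ⟨k, l⟩ h
      fin_cases i <;> fin_cases j <;> fin_cases k <;> fin_cases l <;> simp [hf] at h ⊢ <;> grind
    · intro w
      rcases hall w with rfl | rfl | rfl | rfl | rfl | rfl
      exacts [⟨(0, 0), rfl⟩, ⟨(1, 1), rfl⟩, ⟨(0, 2), rfl⟩, ⟨(1, 2), rfl⟩, ⟨(0, 1), rfl⟩,
        ⟨(1, 0), rfl⟩]
  refine ⟨.symm ⟨Equiv.ofBijective f hbij, fun {r s} => ?_⟩⟩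
  obtain ⟨i, j⟩ := r
  obtain ⟨k, l⟩ := s
  fin_cases i <;> fin_cases j <;> fin_cases k <;> fin_cases l <;>
    simp [hf, boxProd_adj, pathGraph_adj, hxz, hxz.symm, hxy', hxy'.symm, hx'z, hx'z.symm, hx'y,
      hx'y.symm, hvy, hvy.symm, hvz, hvz.symm, hvy', hvy'.symm, hxy, hx'y', G.adj_comm y x,
      G.adj_comm y' x', hPn _ hx _ hv, hPn _ hx _ hx', hPn _ hv _ hx, hPn _ hv _ hx',
      hPn _ hx' _ hx, hPn _ hx' _ hv, hQn _ hy _ hz, hQn _ hy _ hy', hQn _ hz _ hy,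
      hQn _ hz _ hy', hQn _ hy' _ hy, hQn _ hy' _ hz]

/-- The missing edges form a matching, so both coordinates are injective on them. -/
theorem card_nonadj_le {V : Type u} {G : SimpleGraph V} [DecidableRel G.Adj] {P : Set V}
    (hP : IsNearlyComplete G P) {A B : Finset V} (hA : ∀ x ∈ A, x ∈ P) (hB : ∀ y ∈ B, y ∉ P) :
    #(Rel.interedges (fun x y => ¬ G.Adj x y) A B) ≤ #A ∧
      #(Rel.interedges (fun x y => ¬ G.Adj x y) A B) ≤ #B := by
  constructor
  · refine Finset.card_le_card_of_injOn Prod.fst ?_ ?_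
    · rintro ⟨a, b⟩ h
      exact (Rel.mk_mem_interedges_iff.mp h).1
    · rintro ⟨a, b⟩ h ⟨c, d⟩ h' rfl
      obtain ⟨h1, h2, h3⟩ := Rel.mk_mem_interedges_iff.mp h
      obtain ⟨h1', h2', h3'⟩ := Rel.mk_mem_interedges_iff.mp h'
      exact Prod.ext rfl (hP.left _ (hA _ h1) _ (hB _ h2) _ (hB _ h2') h3 h3')
  · refine Finset.card_le_card_of_injOn Prod.snd ?_ ?_
    · rintro ⟨a, b⟩ h
      exact (Rel.mk_mem_interedges_iff.mp h).2.1
    · rintro ⟨a, b⟩ h ⟨c, d⟩ h' rfl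
      obtain ⟨h1, h2, h3⟩ := Rel.mk_mem_interedges_iff.mp h
      obtain ⟨h1', h2', h3'⟩ := Rel.mk_mem_interedges_iff.mp h'
      exact Prod.ext (hP.right _ (hB _ h2) _ (hA _ h1) _ (hA _ h1') h3 h3') rfl

/-- A graph with a vertex of degree three that is complete bipartite up to a matching and has a
tight cut is `P₂ □ P₃`. -/
theorem isLadder_of_tightCut {V : Type u} [Fintype V] [DecidableEq V] {G : SimpleGraph V}
    [DecidableRel G.Adj] (hG : G.Connected) {P : Set V} (hP : IsNearlyComplete G P)
    {v a₁ a₂ a₃ : V} (hv : v ∈ P) (h₁ : G.Adj v a₁) (h₂ : G.Adj v a₂) (h₃ : G.Adj v a₃)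
    (h12 : a₁ ≠ a₂) (h13 : a₁ ≠ a₃) (h23 : a₂ ≠ a₃) {X Y : Finset V} (h : TightCut G X Y) :
    Nonempty (G ≃g (pathGraph 2).boxProd (pathGraph 3)) := by
  classical
  set P₁ := X.filter (· ∈ P) with hP₁
  set P₂ := Y.filter (· ∈ P) with hP₂
  set Q₁ := X.filter (· ∉ P) with hQ₁
  set Q₂ := Y.filter (· ∉ P) with hQ₂
  set A : Finset V := univ.filter (· ∈ P) with hA
  set B : Finset V := univ.filter (· ∉ P) with hB
  have hXY : Disjoint X Y := Finset.disjoint_left.mpr (h.disj · )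
  have hAc : #A = #P₁ + #P₂ := by
    rw [← Finset.card_union_of_disjoint (Finset.disjoint_filter_filter hXY)]
    congr 1
    ext x
    have := h.cover x
    simp [A]; tauto
  have hBc : #B = #Q₁ + #Q₂ := by
    rw [← Finset.card_union_of_disjoint (Finset.disjoint_filter_filter hXY)]
    congr 1
    ext x
    have := h.cover x
    simp [B]; tauto
  have hpos : ∀ {X Y : Finset V}, TightCut G X Y → 0 < #{x ∈ X | x ∈ P} ∧
      0 < #{x ∈ X | x ∉ P} := by
    intro X Y h
    obtain ⟨x, hx, x', hx', hxx'⟩ := h.exists_adj hG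
    have hb := hP.bip x x' hxx'
    by_cases hxP : x ∈ P
    · exact ⟨Finset.card_pos.mpr ⟨x, by simp [hx, hxP]⟩,
        Finset.card_pos.mpr ⟨x', by simp [hx', hb.mp hxP]⟩⟩
    · exact ⟨Finset.card_pos.mpr ⟨x', by simp [hx']; tauto⟩,
        Finset.card_pos.mpr ⟨x, by simp [hx, hxP]⟩⟩
  have hp₁ : 0 < #P₁ := (hpos h).1
  have hq₁ : 0 < #Q₁ := (hpos h).2
  have hp₂ : 0 < #P₂ := (hpos h.symm).1
  have hq₂ : 0 < #Q₂ := (hpos h.symm).2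
  clear hpos
  have haB : ∀ {a}, G.Adj v a → a ∈ B := fun ha => by simp [B, (hP.bip _ _ ha).mp hv]
  have hthree : #({a₁, a₂, a₃} : Finset V) = 3 := Finset.card_eq_three.mpr
    ⟨_, _, _, h12, h13, h23, rfl⟩
  have hsub : ({a₁, a₂, a₃} : Finset V) ⊆ B := by
    intro a ha
    simp only [Finset.mem_insert, Finset.mem_singleton] at ha
    rcases ha with rfl | rfl | rfl
    exacts [haB h₁, haB h₂, haB h₃]
  have hB3 : 3 ≤ #B := hthree ▸ Finset.card_le_card hsub
  have he₁ : #(G.interedges P₁ Q₂) + #(Rel.interedges (fun x y => ¬ G.Adj x y) P₁ Q₂) =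
      #P₁ * #Q₂ := Rel.card_interedges_add_card_interedges_compl ..
  have he₂ : #(G.interedges P₂ Q₁) + #(Rel.interedges (fun x y => ¬ G.Adj x y) P₂ Q₁) =
      #P₂ * #Q₁ := Rel.card_interedges_add_card_interedges_compl ..
  have hm₁ := card_nonadj_le hP (A := P₁) (B := Q₂) (by simp [P₁]) (by simp [Q₂])
  have hm₂ := card_nonadj_le hP (A := P₂) (B := Q₁) (by simp [P₂]) (by simp [Q₁])
  have hle : #(G.interedges P₁ Q₂) + #(G.interedges P₂ Q₁) ≤ #(G.interedges X Y) := by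
    have : Std.Symm G.Adj := ⟨fun _ _ h => h.symm⟩
    have hc : #(G.interedges P₂ Q₁) = #(G.interedges Q₁ P₂) := Rel.card_interedges_comm ..
    rw [hc, ← Finset.card_union_of_disjoint]
    · refine Finset.card_le_card (Finset.union_subset ?_ ?_)
      all_goals exact Rel.interedges_mono (Finset.filter_subset _ _) (Finset.filter_subset _ _)
    · rw [Finset.disjoint_left]
      rintro ⟨x, y⟩ h1 h2
      have := (Rel.mk_mem_interedges_iff.mp h1).1
      have := (Rel.mk_mem_interedges_iff.mp h2).1
      simp_all [P₁, Q₁]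
  have hdegB : ∀ y ∉ P, G.neighborFinset y ⊆ A := fun y hy x hx => by
    rw [mem_neighborFinset] at hx
    simpa [A] using (hP.bip x y hx.symm).mpr hy
  have hdegA : ∀ x ∈ P, G.neighborFinset x ⊆ B := fun x hx y hy => by
    rw [mem_neighborFinset] at hy
    simpa [B] using (hP.bip x y hy).mp hx
  -- A complete bipartite graph has too many edges across. A missing edge `xy` makes both deg x and
  -- deg y one less than the trivial bounds, which is the `+ 1` in the counting lemmas.
  obtain ⟨x, hxP, y, hyP, hxy⟩ : ∃ x ∈ P, ∃ y ∉ P, ¬ G.Adj x y := by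
    by_contra! hall
    have hz : ∀ S T : Finset V, (∀ x ∈ S, x ∈ P) → (∀ y ∈ T, y ∉ P) →
        #(Rel.interedges (fun x y => ¬ G.Adj x y) S T) = 0 := by
      intro S T hS hT
      rw [Finset.card_eq_zero, Finset.eq_empty_iff_forall_notMem]
      rintro ⟨x, y⟩ hxy
      obtain ⟨h1, h2, h3⟩ := Rel.mk_mem_interedges_iff.mp hxy
      exact h3 (hall x (hS x h1) y (hT y h2))
    rw [hz P₁ Q₂ (by simp [P₁]) (by simp [Q₂])] at he₁
    rw [hz P₂ Q₁ (by simp [P₂]) (by simp [Q₁])] at he₂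
    have hd := (h.le_degree a₁).trans (Finset.card_le_card
      (hdegB a₁ (by simpa [B] using haB h₁)))
    rw [hAc] at hd
    rw [hBc] at hB3
    rcases Nat.lt_or_ge 1 #Q₁ with h' | h'
    · nlinarith
    · have : #Q₁ = 1 := by omega
      have : 2 ≤ #Q₂ := by omega
      nlinarith
  have hlt : ∀ {z w : V} {S : Finset V}, G.neighborFinset z ⊆ S → w ∈ S → ¬ G.Adj z w →
      G.degree z + 1 ≤ #S := by
    intro z w S hS hw hzw
    exact Finset.card_lt_card ⟨hS, fun h' => hzw (by simpa using h' hw)⟩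
  have hIA := hlt (hdegB y hyP) (w := x) (by simp [A, hxP]) fun h' => hxy h'.symm
  have hIB := hlt (hdegA x hxP) (w := y) (by simp [B, hyP]) hxy
  have hdx := h.le_degree x
  have hdy := h.le_degree y
  rw [hAc] at hIA
  rw [hBc] at hIB hB3
  have hq := card_right_eq_three hp₁ hp₂ hq₁ hq₂ hB3 he₁ he₂ hm₁.1 hm₁.2 hm₂.1 hm₂.2 (by omega)
  have hBeq : B = {a₁, a₂, a₃} := (Finset.eq_of_subset_of_card_le hsub (by omega)).symm
  have hvall : ∀ y ∉ P, G.Adj v y := fun y hy => by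
    have : y ∈ B := by simp [B, hy]
    rw [hBeq] at this
    simp only [Finset.mem_insert, Finset.mem_singleton] at this
    rcases this with rfl | rfl | rfl <;> assumption
  -- Since `B` consists of three neighbours of `v`, the vertex `v` is in no missing edge and can be
  -- erased from its quarter before counting.
  have hm : #(Rel.interedges (fun x y => ¬ G.Adj x y) P₁ Q₂) +
      #(Rel.interedges (fun x y => ¬ G.Adj x y) P₂ Q₁) + 1 ≤ #P₁ + #P₂ := by
    have key : ∀ S T : Finset V, (∀ x ∈ S, x ∈ P) → (∀ y ∈ T, y ∉ P) →
        #(Rel.interedges (fun x y => ¬ G.Adj x y) S T) ≤ #(S.erase v) := by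
      intro S T hS hT
      refine le_trans (Finset.card_le_card fun p hp => ?_) (card_nonadj_le hP (A := S.erase v)
        (B := T) (fun x hx => hS x (Finset.mem_of_mem_erase hx)) hT).1
      obtain ⟨x, y⟩ := p
      obtain ⟨h1, h2, h3⟩ := Rel.mk_mem_interedges_iff.mp hp
      refine Rel.mk_mem_interedges_iff.mpr ⟨?_, h2, h3⟩
      exact Finset.mem_erase.mpr ⟨by rintro rfl; exact h3 (hvall y (hT y h2)), h1⟩
    have k1 := key P₁ Q₂ (by simp [P₁]) (by simp [Q₂])
    have k2 := key P₂ Q₁ (by simp [P₂]) (by simp [Q₁])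
    rcases h.cover v with hvX | hvY
    · rw [Finset.card_erase_of_mem (by simp [P₁, hvX, hv])] at k1
      have := Finset.card_le_card (Finset.erase_subset v P₂)
      omega
    · rw [Finset.card_erase_of_mem (by simp [P₂, hvY, hv])] at k2
      have := Finset.card_le_card (Finset.erase_subset v P₁)
      omega
  obtain ⟨hp, hm1, hm2⟩ := card_left_eq_three hp₁ hp₂ hq₁ hq₂ hq he₁ he₂ hm₁.1 hm₁.2 hm₂.1 hm₂.2
    hm (by omega) (by omega)
  obtain ⟨⟨x, y⟩, hxy⟩ := Finset.card_pos.mp hm1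
  obtain ⟨⟨x', y'⟩, hxy'⟩ := Finset.card_pos.mp hm2
  clear hIA hIB hdx hdy
  obtain ⟨hx, hy, hxy⟩ := Rel.mk_mem_interedges_iff.mp hxy
  obtain ⟨hx', hy', hxy'⟩ := Rel.mk_mem_interedges_iff.mp hxy'
  simp only [P₁, P₂, Q₁, Q₂, Finset.mem_filter] at hx hy hx' hy'
  have hxx' : x ≠ x' := by rintro rfl; exact h.disj x hx.1 hx'.1
  have hyy' : y ≠ y' := by rintro rfl; exact h.disj y hy'.1 hy.1
  have hvx : v ≠ x := by rintro rfl; exact hxy (hvall y hy.2)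
  have hvx' : v ≠ x' := by rintro rfl; exact hxy' (hvall y' hy'.2)
  have hAeq : ({x, v, x'} : Finset V) = A := by
    refine Finset.eq_of_subset_of_card_le (fun w hw => ?_) ?_
    · simp only [Finset.mem_insert, Finset.mem_singleton] at hw
      have hPA : ∀ {w}, w ∈ P → w ∈ A := by simp [A]
      rcases hw with rfl | rfl | rfl
      exacts [hPA hx.2, hPA hv, hPA hx'.2]
    · rw [hAc, hp, Finset.card_eq_three.mpr ⟨_, _, _, hvx.symm, hxx', hvx', rfl⟩]
  obtain ⟨z, hz, hzn⟩ : ∃ z ∈ B, z ∉ ({y, y'} : Finset V) :=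
    Finset.exists_mem_notMem_of_card_lt_card (by rw [Finset.card_pair hyy', hBc]; omega)
  simp only [Finset.mem_insert, Finset.mem_singleton, not_or] at hzn
  have hzP : z ∉ P := by simpa [B] using hz
  have hBeq' : ({y, z, y'} : Finset V) = B := by
    refine Finset.eq_of_subset_of_card_le (fun w hw => ?_) ?_
    · simp only [Finset.mem_insert, Finset.mem_singleton] at hw
      have hPB : ∀ {w}, w ∉ P → w ∈ B := by simp [B]
      rcases hw with rfl | rfl | rfl
      exacts [hPB hy.2, hPB hzP, hPB hy'.2]
    · rw [hBc, hq, Finset.card_eq_three.mpr ⟨_, _, _, Ne.symm hzn.1, hyy', hzn.2, rfl⟩]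
  have hadj : ∀ {a b c}, a ∈ P → b ∉ P → c ∉ P → ¬ G.Adj a b → c ≠ b → G.Adj a c :=
    fun ha hb hc hab hcb => by_contra fun hac => hcb (hP.left _ ha _ hc _ hb hac hab)
  refine isLadder_of_adj (x := x) (v := v) (x' := x') (y := y) (z := z) (y' := y')
    (hadj hx.2 hy.2 hzP hxy hzn.1) (hadj hx.2 hy.2 hy'.2 hxy hyy'.symm)
    (hadj hx'.2 hy'.2 hzP hxy' hzn.2) (hadj hx'.2 hy'.2 hy.2 hxy' hyy')
    (hvall y hy.2) (hvall z hzP) (hvall y' hy'.2) hxy hxy' hP.bip hx.2 hv hx'.2 hy.2 hzP hy'.2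
    hxx' hyy' fun w => ?_
  by_cases hw : w ∈ P
  · have : w ∈ A := by simp [A, hw]
    rw [← hAeq] at this
    simp at this; tauto
  · have : w ∈ B := by simp [B, hw]
    rw [← hBeq'] at this
    simp at this; tauto

/-- A connected graph without triangles and induced `T₁₁₂` that is not super-edge-connected is
`P₂ □ P₃`, a path or a cycle. -/
theorem isLadderPathOrCycle_of_not_isSuperEdgeConnected {V : Type u} [Finite V]
    {G : SimpleGraph V} (hG : G.Connected)
    (hT : ∀ a b c, G.Adj a b → G.Adj b c → ¬ G.Adj a c)
    (hF : ∀ c a b d e, G.Adj c a → G.Adj c b → G.Adj c d → G.Adj d e → a ≠ b → a ≠ d → b ≠ d →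
      e ≠ c → G.Adj e a ∨ G.Adj e b)
    (hs : ¬ IsSuperEdgeConnected G) : IsLadderPathOrCycle G := by
  classical
  have := Fintype.ofFinite V
  obtain ⟨X, Y, h⟩ := exists_tightCut hG hs
  by_cases hdeg : ∀ v a b c, G.Adj v a → G.Adj v b → G.Adj v c → a = b ∨ a = c ∨ b = c
  · have hcard : 4 ≤ Nat.card V := by
      have h1 := h.one_lt_left
      have h2 := h.one_lt_right
      have h3 := Finset.card_union_of_disjoint (Finset.disjoint_left.mpr (h.disj · ))
      have h4 := Finset.card_le_univ (X ∪ Y)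
      rw [Nat.card_eq_fintype_card]
      omega
    exact .inr ⟨_, hcard, exists_iso_path_or_cycle hG hdeg (by omega)⟩
  · push Not at hdeg
    obtain ⟨v, a₁, a₂, a₃, h₁, h₂, h₃, h12, h13, h23⟩ := hdeg
    obtain ⟨P, hP, hv⟩ := exists_isNearlyComplete hG hT hF h₁ h₂ h₃ h12 h13 h23
    exact .inl (isLadder_of_tightCut hG hP hv h₁ h₂ h₃ h12 h13 h23 h)

/-! ### Sufficiency: from forbidden induced subgraphs to adjacency -/

theorem isIndContained_of_lt {V : Type u} {G : SimpleGraph V} {n : ℕ} {H : SimpleGraph (Fin n)}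
    (f : Fin n → V) (hne : ∀ i j, i < j → f i ≠ f j)
    (hadj : ∀ i j, i < j → (G.Adj (f i) (f j) ↔ H.Adj i j)) : H.IsIndContained G := by
  refine ⟨⟨⟨f, fun i j h => ?_⟩, fun {i j} => ?_⟩⟩
  · rcases lt_trichotomy i j with h' | h' | h'
    exacts [absurd h (hne i j h'), h', absurd h.symm (hne j i h')]
  · change G.Adj (f i) (f j) ↔ H.Adj i j
    rcases lt_trichotomy i j with h' | rfl | h'
    · exact hadj i j h'
    · simp
    · rw [G.adj_comm, H.adj_comm]; exact hadj j i h'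

theorem adj_of_pathGraph_four_free {V : Type u} {G : SimpleGraph V}
    (h : ¬ (pathGraph 4).IsIndContained G) (p q r s : V) (hpq : G.Adj p q) (hqr : G.Adj q r)
    (hrs : G.Adj r s) : G.Adj p r ∨ G.Adj q s ∨ G.Adj p s := by
  by_contra! hc
  have := hpq.ne; have := hqr.ne; have := hrs.ne
  refine h (isIndContained_of_lt ![p, q, r, s] ?_ ?_) <;> intro i j hij <;>
    fin_cases i <;> fin_cases j <;> simp at hij <;> simp [pathGraph_adj, *]
  · rintro rfl; exact hc.2.2 hrs
  · rintro rfl; exact hc.1 hrs.symm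
  · rintro rfl; exact hc.2.2 hpq

theorem adj_of_H0_free {V : Type u} {G : SimpleGraph V}
    (h : ¬ H0.IsIndContained G) (c a b d e : V) (hca : G.Adj c a) (hcb : G.Adj c b)
    (hab : G.Adj a b) (hcd : G.Adj c d) (hce : G.Adj c e) (hde : G.Adj d e) :
    G.Adj a d ∨ G.Adj a e ∨ G.Adj b d ∨ G.Adj b e := by
  by_contra! hc
  have := hca.ne; have := hcb.ne; have := hab.ne; have := hcd.ne; have := hce.ne; have := hde.ne
  have : a ≠ d := by rintro rfl; exact hc.2.1 hde
  have : a ≠ e := by rintro rfl; exact hc.1 hde.symm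
  have : b ≠ d := by rintro rfl; exact hc.2.2.2 hde
  have : b ≠ e := by rintro rfl; exact hc.2.2.1 hde.symm
  refine h (isIndContained_of_lt ![c, a, b, d, e] ?_ ?_) <;> intro i j hij <;>
    fin_cases i <;> fin_cases j <;> simp at hij <;> simp [H0, *]

theorem adj_of_Z1_free {V : Type u} {G : SimpleGraph V}
    (h : ¬ Z1.IsIndContained G) (a b c d : V) (hab : G.Adj a b) (hac : G.Adj a c)
    (hbc : G.Adj b c) (had : G.Adj a d) : b = d ∨ c = d ∨ G.Adj b d ∨ G.Adj c d := by
  by_contra! hc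
  have := hab.ne; have := hac.ne; have := hbc.ne; have := had.ne
  refine h (isIndContained_of_lt ![a, b, c, d] ?_ ?_) <;> intro i j hij <;>
    fin_cases i <;> fin_cases j <;> simp at hij <;> simp [Z1, *]

theorem adj_of_T112_free {V : Type u} {G : SimpleGraph V}
    (h : ¬ T112.IsIndContained G) (hT : ∀ a b c, G.Adj a b → G.Adj b c → ¬ G.Adj a c)
    (c a b d e : V) (hca : G.Adj c a) (hcb : G.Adj c b) (hcd : G.Adj c d) (hde : G.Adj d e)
    (hab : a ≠ b) (had : a ≠ d) (hbd : b ≠ d) (hec : e ≠ c) : G.Adj e a ∨ G.Adj e b := by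
  by_contra! hc
  have := hca.ne; have := hcb.ne; have := hcd.ne; have := hde.ne
  have h1 := hT a c b hca.symm hcb
  have h2 := hT a c d hca.symm hcd
  have h3 := hT b c d hcb.symm hcd
  have h4 := hT c d e hcd hde
  have : a ≠ e := by rintro rfl; exact h4 hca
  have : b ≠ e := by rintro rfl; exact h4 hcb
  have := hec.symm
  have : ¬ G.Adj a e := fun h' => hc.1 h'.symm
  have : ¬ G.Adj b e := fun h' => hc.2 h'.symm
  refine h (isIndContained_of_lt ![c, a, b, d, e] ?_ ?_) <;> intro i j hij <;>
    fin_cases i <;> fin_cases j <;> simp at hij <;> simp [T112, *]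

theorem isSuperEdgeConnected_iff_not_isC4 {V : Type u} [Finite V] {G : SimpleGraph V}
    (hG : G.Connected) (hH : ¬ H0.IsIndContained G) (hP : ¬ (pathGraph 4).IsIndContained G) :
    IsSuperEdgeConnected G ↔ ¬ IsC4 G :=
  ⟨fun h hC => not_isSuperEdgeConnected_of_isC4 hC h, fun hC => by_contra fun h =>
    hC (isC4_of_not_isSuperEdgeConnected hG (adj_of_pathGraph_four_free hP)
      (adj_of_H0_free hH) h)⟩

theorem IsC4.isLadderPathOrCycle {V : Type u} {G : SimpleGraph V} (h : IsC4 G) :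
    IsLadderPathOrCycle G := .inr ⟨4, le_rfl, .inr h⟩

theorem isSuperEdgeConnected_iff_not_isLadderPathOrCycle {V : Type u} [Finite V]
    {G : SimpleGraph V} (hG : G.Connected) (hZ : ¬ Z1.IsIndContained G)
    (hF : ¬ T112.IsIndContained G) : IsSuperEdgeConnected G ↔ ¬ IsLadderPathOrCycle G := by
  refine ⟨fun h hC => not_isSuperEdgeConnected_of_isLadderPathOrCycle hC h, fun hC =>
    by_contra fun h => hC ?_⟩
  by_cases hT : ∀ a b c, G.Adj a b → G.Adj b c → ¬ G.Adj a c
  · exact isLadderPathOrCycle_of_not_isSuperEdgeConnected hG hT (adj_of_T112_free hF hT) h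
  push Not at hT
  obtain ⟨x, y, z, hxy, hyz, hxz⟩ := hT
  -- In a complete multipartite graph every edge dominates, which excludes P₄ and H₀.
  have key : ∀ {a b}, G.Adj a b → ∀ c, G.Adj c a ∨ G.Adj c b :=
    adj_or_adj_of_triangle hG (adj_of_Z1_free hZ) hxy hxz hyz
  refine (isC4_of_not_isSuperEdgeConnected hG ?_ ?_ h).isLadderPathOrCycle
  · intro p q r s hpq _ _
    rcases key hpq s with h | h
    exacts [.inr (.inr h.symm), .inr (.inl h.symm)]
  · intro c a b d e _ _ hab _ _ _
    rcases key hab d with h | h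
    exacts [.inl h.symm, .inr (.inr (.inl h.symm))]

theorem PairPrec.not_isIndContained {α : Type u} {β : Type v} {γ δ : Type} {V : Type w}
    {R : SimpleGraph α} {S : SimpleGraph β} {A : SimpleGraph γ} {B : SimpleGraph δ}
    {G : SimpleGraph V} (h : PairPrec R S A B) (hG : PairFree R S G) :
    ¬ A.IsIndContained G ∧ ¬ B.IsIndContained G :=
  ⟨fun hA => h.1.elim (fun h => hG.1 (h.trans hA)) fun h => hG.2 (h.trans hA),
    fun hB => h.2.elim (fun h => hG.1 (h.trans hB)) fun h => hG.2 (h.trans hB)⟩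

/-! ### Necessity: the test graphs -/

theorem val_of_cycleGraph_adj {n : ℕ} {i j : Fin n} (h : (cycleGraph n).Adj i j) :
    i.val + 1 = j.val ∨ j.val + 1 = i.val ∨ i.val = 0 ∧ j.val + 1 = n ∨
      j.val = 0 ∧ i.val + 1 = n := by
  rcases lt_trichotomy i j with h' | rfl | h'
  · rw [cycleGraph_adj_iff_of_lt h'] at h; tauto
  · exact absurd h (cycleGraph n).irrefl
  · rw [adj_comm, cycleGraph_adj_iff_of_lt h'] at h; tauto

theorem IsLadderPathOrCycle.not_adj {V : Type u} {G : SimpleGraph V} (h : IsLadderPathOrCycle G)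
    {a b c : V} (hab : G.Adj a b) (hbc : G.Adj b c) : ¬ G.Adj a c := by
  intro hac
  rcases h with ⟨⟨e⟩⟩ | ⟨n, hn, ⟨⟨e⟩⟩ | ⟨⟨e⟩⟩⟩ <;>
    rw [← e.map_adj_iff] at hab hbc hac
  · simp only [boxProd_adj, pathGraph_adj, Fin.ext_iff] at hab hbc hac
    omega
  · simp only [pathGraph_adj] at hab hbc hac
    omega
  · have := val_of_cycleGraph_adj hab
    have := val_of_cycleGraph_adj hbc
    have := val_of_cycleGraph_adj hac
    omega

theorem IsLadderPathOrCycle.of_iso {V : Type u} {W : Type v} {G : SimpleGraph V}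
    {H : SimpleGraph W} (e : H ≃g G) (h : IsLadderPathOrCycle G) : IsLadderPathOrCycle H := by
  rcases h with ⟨⟨f⟩⟩ | ⟨n, hn, ⟨⟨f⟩⟩ | ⟨⟨f⟩⟩⟩
  · exact .inl ⟨e.trans f⟩
  · exact .inr ⟨n, hn, .inl ⟨e.trans f⟩⟩
  · exact .inr ⟨n, hn, .inr ⟨e.trans f⟩⟩

theorem not_isLadderPathOrCycle_T112 : ¬ IsLadderPathOrCycle T112 := by
  have h1 : T112.Adj 0 1 := by simp [T112]
  have h2 : T112.Adj 0 2 := by simp [T112]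
  have h3 : T112.Adj 0 3 := by simp [T112]
  rintro (⟨⟨e⟩⟩ | ⟨n, hn, ⟨⟨e⟩⟩ | ⟨⟨e⟩⟩⟩)
  · simpa using Fintype.card_congr e.toEquiv
  all_goals
    have h12 : (e 1).val ≠ (e 2).val := fun h => by simpa using e.injective (Fin.ext h)
    have h13 : (e 1).val ≠ (e 3).val := fun h => by simpa using e.injective (Fin.ext h)
    have h23 : (e 2).val ≠ (e 3).val := fun h => by simpa using e.injective (Fin.ext h)
    rw [← e.map_adj_iff] at h1 h2 h3
  · rw [pathGraph_adj] at h1 h2 h3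
    omega
  · have := val_of_cycleGraph_adj h1
    have := val_of_cycleGraph_adj h2
    have := val_of_cycleGraph_adj h3
    omega

theorem not_isLadderPathOrCycle_H0 : ¬ IsLadderPathOrCycle H0 := fun h =>
  h.not_adj (a := 0) (b := 1) (c := 2) (by simp [H0]) (by simp [H0]) (by simp [H0])

theorem not_isLadderPathOrCycle_linkedTriangles : ¬ IsLadderPathOrCycle linkedTriangles := fun h =>
  h.not_adj (a := 0) (b := 1) (c := 2) (by simp [linkedTriangles]) (by simp [linkedTriangles])
    (by simp [linkedTriangles])

/-- Otherwise `K` would be a counterexample to `h`; `ULift` moves it to the universe of `h`. -/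
theorem isIndContained_or_of_forall {α : Type u} {β : Type v} {R : SimpleGraph α}
    {S : SimpleGraph β}
    (h : ∀ (V : Type w) [Finite V] (G : SimpleGraph V), G.Connected → PairFree R S G →
      ¬ IsLadderPathOrCycle G → IsSuperEdgeConnected G)
    {γ : Type} [Finite γ] {K : SimpleGraph γ} (hK : K.Connected) (hs : ¬ IsSuperEdgeConnected K)
    (hl : ¬ IsLadderPathOrCycle K) : R.IsIndContained K ∨ S.IsIndContained K := by
  by_contra! hc
  have e : K.comap (Equiv.ulift.{w} : ULift γ ≃ γ) ≃g K := Iso.comap Equiv.ulift K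
  exact hs (IsSuperEdgeConnected.of_iso e.symm hK <|
    h _ _ (e.connected_iff.mpr hK)
      ⟨fun hR => hc.1 (hR.trans ⟨e.toEmbedding⟩), fun hS => hc.2 (hS.trans ⟨e.toEmbedding⟩)⟩
      fun hl' => hl (hl'.of_iso e.symm))

/-- Used when the image of `f` misses vertices of `H`: only the values of `g` on `p` matter, and the
others are filled with an arbitrary 0. -/
theorem isIndContained_of_mapsTo {α : Type u} {V : Type v} {W : Type w} {R : SimpleGraph α}
    {H : SimpleGraph V} {K : SimpleGraph W} (f : R ↪g H) (p : V → Prop) (hf : ∀ a, p (f a))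
    (g : V → W)
    (hg : ∀ i j, p i → p j → (g i = g j → i = j) ∧ (K.Adj (g i) (g j) ↔ H.Adj i j)) :
    R.IsIndContained K :=
  ⟨⟨⟨fun a => g (f a), fun a b h => f.injective ((hg _ _ (hf a) (hf b)).1 h)⟩,
    fun {a b} => (hg _ _ (hf a) (hf b)).2.trans f.map_adj_iff⟩⟩

/-- The image of a connected graph lies in a set that its vertices cannot leave along edges. -/
theorem forall_of_connected {α : Type u} {V : Type v} {R : SimpleGraph α} {H : SimpleGraph V}
    (hR : R.Connected) (f : R ↪g H) (p q : V → Prop) (hp : ∀ a, p (f a))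
    (hq : ∀ i j, H.Adj i j → p i → p j → q i → q j) {a : α} (ha : q (f a)) (b : α) : q (f b) := by
  have hwalk : ∀ a b, R.Walk a b → q (f a) → q (f b) := by
    intro a b w
    induction w with
    | nil => exact id
    | cons had _ ih => exact fun h => ih (hq _ _ (f.map_adj_iff.mpr had) (hp _) (hp _) h)
  exact (hR.preconnected a b).elim fun w => hwalk _ _ w ha

/-! ### Necessity: connected induced subgraphs of the test graphs -/

/-- An induced claw. -/
def HasClaw {V : Type u} (G : SimpleGraph V) : Prop :=
  ∃ c a b d, G.Adj c a ∧ G.Adj c b ∧ G.Adj c d ∧ a ≠ b ∧ a ≠ d ∧ b ≠ d ∧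
    ¬ G.Adj a b ∧ ¬ G.Adj a d ∧ ¬ G.Adj b d

theorem HasClaw.of_isIndContained {V : Type u} {W : Type v} {G : SimpleGraph V}
    {H : SimpleGraph W} (h : HasClaw G) (hGH : G.IsIndContained H) : HasClaw H := by
  obtain ⟨f⟩ := hGH
  obtain ⟨c, a, b, d, h⟩ := h
  exact ⟨f c, f a, f b, f d, by simpa [f.map_adj_iff, f.injective.eq_iff] using h⟩

/-- A graph covered by two cliques has no claw. -/
theorem not_hasClaw_of_two_cliques {V : Type u} {G : SimpleGraph V} (t : V → Bool)
    (ht : ∀ a b, a ≠ b → t a = t b → G.Adj a b) : ¬ HasClaw G := by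
  rintro ⟨c, a, b, d, -, -, -, hab, had, hbd, h1, h2, h3⟩
  have key : ∀ x y z : Bool, x ≠ y → x ≠ z → y ≠ z → False := by decide
  exact key _ _ _ (mt (ht a b hab) h1) (mt (ht a d had) h2) (mt (ht b d hbd) h3)

theorem not_hasClaw_H0 : ¬ HasClaw H0 := by
  refine not_hasClaw_of_two_cliques ![true, true, true, false, false] fun a b => ?_
  fin_cases a <;> fin_cases b <;> simp [H0]

theorem not_hasClaw_linkedTriangles : ¬ HasClaw linkedTriangles := by
  refine not_hasClaw_of_two_cliques ![true, true, true, false, false, false] fun a b => ?_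
  fin_cases a <;> fin_cases b <;> simp [linkedTriangles]

/-- Arithmetic form for `omega`: (i + 1) / 2 numbers the triangle of a non-central vertex. -/
theorem H0_adj_iff (i j : Fin 5) : H0.Adj i j ↔
    i.val ≠ j.val ∧ (i.val = 0 ∨ j.val = 0 ∨ (i.val + 1) / 2 = (j.val + 1) / 2) := by
  fin_cases i <;> fin_cases j <;> simp [H0]

theorem linkedTriangles_adj_iff (i j : Fin 6) : linkedTriangles.Adj i j ↔
    i.val ≠ j.val ∧ (i.val / 3 = j.val / 3 ∨ i.val % 3 = 0 ∧ j.val % 3 = 0) := by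
  fin_cases i <;> fin_cases j <;> simp [linkedTriangles]

/-- The linking edge lies in no triangle. -/
theorem linkedTriangles_val_eq (i j k : Fin 6) (hij : linkedTriangles.Adj i j)
    (hik : linkedTriangles.Adj i k) (hjk : linkedTriangles.Adj j k) :
    j.val / 3 = i.val / 3 := by
  rw [linkedTriangles_adj_iff] at hij hik hjk
  omega

theorem H0_adj_of_path (p q r s : Fin 5) (hpq : H0.Adj p q) (hqr : H0.Adj q r)
    (hrs : H0.Adj r s) : H0.Adj p r ∨ H0.Adj q s ∨ H0.Adj p s := by
  rw [H0_adj_iff] at *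
  rw [H0_adj_iff, H0_adj_iff]
  omega

/-- Missing a leaf at the centre leaves a P₄. With both such leaves, connectedness brings in the
centre 0; without 3 also 4 is lost and only a P₃ remains, so 3 is present and completes a claw. -/
theorem isIndContained_P4_or_hasClaw {α : Type u} {R : SimpleGraph α} (hR : R.Connected)
    (hR3 : ¬ R.IsIndContained (pathGraph 3)) (hRT : R.IsIndContained T112) :
    R.IsIndContained (pathGraph 4) ∨ HasClaw R := by
  obtain ⟨f⟩ := hRT
  by_cases h1 : ∃ a, f a = 1
  swap
  · push Not at h1
    refine .inl (isIndContained_of_mapsTo f (· ≠ 1) h1 ![1, 0, 0, 2, 3] fun i j => ?_)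
    fin_cases i <;> fin_cases j <;> simp [T112, pathGraph_adj]
  by_cases h2 : ∃ a, f a = 2
  swap
  · push Not at h2
    refine .inl (isIndContained_of_mapsTo f (· ≠ 2) h2 ![1, 0, 0, 2, 3] fun i j => ?_)
    fin_cases i <;> fin_cases j <;> simp [T112, pathGraph_adj]
  obtain ⟨a, ha⟩ := h1
  obtain ⟨b, hb⟩ := h2
  by_cases h0 : ∃ a, f a = 0
  swap
  · push Not at h0
    have := forall_of_connected hR f (· ≠ 0) (· = 1) h0 (fun i j => by
      fin_cases i <;> fin_cases j <;> simp [T112]) ha b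
    simp [hb] at this
  by_cases h3 : ∃ a, f a = 3
  swap
  · push Not at h3
    have h4 := forall_of_connected hR f (· ≠ 3) (· ≠ 4) h3 (fun i j => by
      fin_cases i <;> fin_cases j <;> simp [T112]) (a := a) (by simp [ha])
    refine absurd (isIndContained_of_mapsTo f (fun i => i ≠ 3 ∧ i ≠ 4) (fun a => ⟨h3 a, h4 a⟩)
      ![1, 0, 2, 0, 0] fun i j => ?_) hR3
    fin_cases i <;> fin_cases j <;> simp [T112, pathGraph_adj]
  obtain ⟨c, hc⟩ := h0
  obtain ⟨d, hd⟩ := h3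
  refine .inr ⟨c, a, b, d, ?_⟩
  simp only [← f.map_adj_iff, ← f.injective.ne_iff, ha, hb, hc, hd]
  simp [T112]

/-- H₀ has no claw, which leaves R inside P₄. As H₀ has no induced P₄, R has diameter at most two,
so it misses an end of P₄ and lies in P₃. -/
theorem not_isIndContained_H0_of_T112 {α : Type u} {R : SimpleGraph α} (hR : R.Connected)
    (hR3 : ¬ R.IsIndContained (pathGraph 3)) (hRT : R.IsIndContained T112) :
    ¬ R.IsIndContained H0 := by
  intro hH
  rcases isIndContained_P4_or_hasClaw hR hR3 hRT with h | h
  swap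
  · exact not_hasClaw_H0 (h.of_isIndContained hH)
  obtain ⟨f⟩ := h
  obtain ⟨g⟩ := hH
  have hdiam := exists_common_neighbor hR fun p q r s h1 h2 h3 => by
    simp only [← g.map_adj_iff] at *
    exact H0_adj_of_path _ _ _ _ h1 h2 h3
  by_cases h0 : ∃ a, f a = 0
  swap
  · push Not at h0
    refine hR3 (isIndContained_of_mapsTo f (· ≠ 0) h0 ![0, 0, 1, 2] fun i j => ?_)
    fin_cases i <;> fin_cases j <;> simp [pathGraph_adj]
  by_cases h3 : ∃ a, f a = 3
  swap
  · push Not at h3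
    refine hR3 (isIndContained_of_mapsTo f (· ≠ 3) h3 ![0, 1, 2, 0] fun i j => ?_)
    fin_cases i <;> fin_cases j <;> simp [pathGraph_adj]
  obtain ⟨a, ha⟩ := h0
  obtain ⟨b, hb⟩ := h3
  rcases hdiam a b with rfl | h | ⟨u, h1, h2⟩
  · simp [ha] at hb
  · rw [← f.map_adj_iff, ha, hb] at h
    simp [pathGraph_adj] at h
  · rw [← f.map_adj_iff, pathGraph_adj] at h1 h2
    rw [ha] at h1
    rw [hb] at h2
    have := (f u).isLt
    simp at h1 h2
    omega

/-- Deleting a non-central vertex of H₀ leaves Z₁. If none is missed, connectedness gives all of H₀,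
but two triangles through a common vertex of the linked triangles have the same vertex set. -/
theorem isIndContained_Z1 {α : Type u} {S : SimpleGraph α} (hS : S.Connected)
    (hH : S.IsIndContained H0)
    (hL : S.IsIndContained linkedTriangles) : S.IsIndContained Z1 := by
  obtain ⟨f⟩ := hH
  obtain ⟨g⟩ := hL
  by_cases h1 : ∃ a, f a = 1
  swap
  · push Not at h1
    refine isIndContained_of_mapsTo f (· ≠ 1) h1 ![0, 0, 3, 1, 2] fun i j => ?_
    fin_cases i <;> fin_cases j <;> simp [H0, Z1]
  by_cases h2 : ∃ a, f a = 2
  swap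
  · push Not at h2
    refine isIndContained_of_mapsTo f (· ≠ 2) h2 ![0, 3, 0, 1, 2] fun i j => ?_
    fin_cases i <;> fin_cases j <;> simp [H0, Z1]
  by_cases h3 : ∃ a, f a = 3
  swap
  · push Not at h3
    refine isIndContained_of_mapsTo f (· ≠ 3) h3 ![0, 1, 2, 0, 3] fun i j => ?_
    fin_cases i <;> fin_cases j <;> simp [H0, Z1]
  by_cases h4 : ∃ a, f a = 4
  swap
  · push Not at h4
    refine isIndContained_of_mapsTo f (· ≠ 4) h4 ![0, 1, 2, 3, 0] fun i j => ?_
    fin_cases i <;> fin_cases j <;> simp [H0, Z1]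
  obtain ⟨a, ha⟩ := h1
  obtain ⟨b, hb⟩ := h2
  obtain ⟨d, hd⟩ := h3
  obtain ⟨e, he⟩ := h4
  by_cases h0 : ∃ a, f a = 0
  swap
  · push Not at h0
    have := forall_of_connected hS f (· ≠ 0) (fun i => i = 1 ∨ i = 2) h0
      (fun i j hij hi hj h => by
        rw [H0_adj_iff] at hij
        simp only [Fin.ext_iff, ne_eq] at hi hj h ⊢
        simp only [Fin.isValue, Fin.val_zero, Fin.val_one, Fin.val_two] at hi hj h ⊢
        omega) (.inl ha) d
    simp [hd] at this
  exfalso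
  obtain ⟨c, hc⟩ := h0
  have key : ∀ {x y : α}, H0.Adj (f x) (f y) → linkedTriangles.Adj (g x) (g y) := fun h =>
    g.map_adj_iff.mpr (f.map_adj_iff.mp h)
  have had : ¬ linkedTriangles.Adj (g a) (g d) := by
    rw [g.map_adj_iff, ← f.map_adj_iff, ha, hd]; simp [H0]
  have hne : g a ≠ g d := by
    rw [g.injective.ne_iff, ← f.injective.ne_iff, ha, hd]; simp
  have hac := linkedTriangles_val_eq (g c) (g a) (g b) (key (by rw [hc, ha]; simp [H0]))
    (key (by rw [hc, hb]; simp [H0])) (key (by rw [ha, hb]; simp [H0]))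
  have hdc := linkedTriangles_val_eq (g c) (g d) (g e) (key (by rw [hc, hd]; simp [H0]))
    (key (by rw [hc, he]; simp [H0])) (key (by rw [hd, he]; simp [H0]))
  exact had ((linkedTriangles_adj_iff _ _).mpr ⟨Fin.val_ne_of_ne hne, .inl (hac.trans hdc.symm)⟩)

theorem PairPrec.symm {α : Type u} {β : Type v} {γ δ : Type} {R : SimpleGraph α}
    {S : SimpleGraph β} {A : SimpleGraph γ} {B : SimpleGraph δ} (h : PairPrec R S A B) :
    PairPrec S R A B := ⟨h.1.symm, h.2.symm⟩

theorem pairPrec_of_isIndContained_T112 {α : Type u} {β : Type v} {R : SimpleGraph α}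
    {S : SimpleGraph β} (hR : R.Connected) (hS : S.Connected)
    (hR3 : ¬ R.IsIndContained (pathGraph 3)) (hT : R.IsIndContained T112)
    (hH : R.IsIndContained H0 ∨ S.IsIndContained H0)
    (hL : R.IsIndContained linkedTriangles ∨ S.IsIndContained linkedTriangles) :
    PairPrec R S H0 (pathGraph 4) ∨ PairPrec R S Z1 T112 := by
  have hSH := hH.resolve_left (not_isIndContained_H0_of_T112 hR hR3 hT)
  rcases hL with hL | hL
  · rcases isIndContained_P4_or_hasClaw hR hR3 hT with h | h
    · exact .inl ⟨.inr hSH, .inl h⟩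
    · exact absurd (h.of_isIndContained hL) not_hasClaw_linkedTriangles
  · exact .inr ⟨.inr (isIndContained_Z1 hS hSH hL), .inl hT⟩

end SuperEdge

theorem theorem2p2 {α : Type u} {β : Type v} [Finite α] [Finite β]
    (R : SimpleGraph α) (S : SimpleGraph β) (hR : R.Connected) (hS : S.Connected)
    (hR3 : ¬ R.IsIndContained (SimpleGraph.pathGraph 3))
    (hS3 : ¬ S.IsIndContained (SimpleGraph.pathGraph 3)) :
    -- the pairs for which all but the exceptional graphs are super-edge-connected
    ((∀ (V : Type w) [Finite V] (G : SimpleGraph V), G.Connected → SuperEdge.PairFree R S G →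
        ¬ SuperEdge.IsLadderPathOrCycle G → SuperEdge.IsSuperEdgeConnected G) ↔
      (SuperEdge.PairPrec R S SuperEdge.H0 (SimpleGraph.pathGraph 4) ∨
        SuperEdge.PairPrec R S SuperEdge.Z1 SuperEdge.T112)) ∧
    -- the exact exceptions in case (i)
    (SuperEdge.PairPrec R S SuperEdge.H0 (SimpleGraph.pathGraph 4) →
      ∀ (V : Type w) [Finite V] (G : SimpleGraph V), G.Connected → SuperEdge.PairFree R S G →
        (SuperEdge.IsSuperEdgeConnected G ↔ ¬ SuperEdge.IsC4 G)) ∧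
    -- the exact exceptions in case (ii)
    (SuperEdge.PairPrec R S SuperEdge.Z1 SuperEdge.T112 →
      ∀ (V : Type w) [Finite V] (G : SimpleGraph V), G.Connected → SuperEdge.PairFree R S G →
        (SuperEdge.IsSuperEdgeConnected G ↔ ¬ SuperEdge.IsLadderPathOrCycle G)) := by
  open SuperEdge in
  have hi : PairPrec R S H0 (SimpleGraph.pathGraph 4) →
      ∀ (V : Type w) [Finite V] (G : SimpleGraph V), G.Connected → PairFree R S G →
        (IsSuperEdgeConnected G ↔ ¬ IsC4 G) := fun h V _ G hG hf =>
    isSuperEdgeConnected_iff_not_isC4 hG (h.not_isIndContained hf).1 (h.not_isIndContained hf).2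
  open SuperEdge in
  have hii : PairPrec R S Z1 T112 →
      ∀ (V : Type w) [Finite V] (G : SimpleGraph V), G.Connected → PairFree R S G →
        (IsSuperEdgeConnected G ↔ ¬ IsLadderPathOrCycle G) := fun h V _ G hG hf =>
    isSuperEdgeConnected_iff_not_isLadderPathOrCycle hG (h.not_isIndContained hf).1
      (h.not_isIndContained hf).2
  refine ⟨⟨fun h => ?_, ?_⟩, hi, hii⟩
  · open SuperEdge in
    have hT := isIndContained_or_of_forall h T112_connected not_isSuperEdgeConnected_T112
      not_isLadderPathOrCycle_T112
    open SuperEdge in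
    have hH := isIndContained_or_of_forall h H0_connected not_isSuperEdgeConnected_H0
      not_isLadderPathOrCycle_H0
    open SuperEdge in
    have hL := isIndContained_or_of_forall h linkedTriangles_connected
      not_isSuperEdgeConnected_linkedTriangles not_isLadderPathOrCycle_linkedTriangles
    rcases hT with hT | hT
    · exact SuperEdge.pairPrec_of_isIndContained_T112 hR hS hR3 hT hH hL
    · exact (SuperEdge.pairPrec_of_isIndContained_T112 hS hR hS3 hT hH.symm hL.symm).imp
        (·.symm) (·.symm)
  · rintro (h | h) V _ G hG hf hl
    · exact (hi h V G hG hf).mpr fun hC => hl hC.isLadderPathOrCycle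
    · exact (hii h V G hG hf).mpr hl
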